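/- **Definitions.** Let $\mathcal H=\mathcal H^A\otimes\mathcal H^B$ be a finite-dimensional bipartite state space. An *instrument* over a finite or countably infinite index set $\Theta$ is a family $(\mathcal E_j)_{j\in\Theta}$ of completely positive (CP) maps on $\mathcal B(\mathcal H)$ whose sum is trace-preserving. A *coarse-graining* of it along a map $f:\Theta\to\Theta'$ is the instrument $\bigl(\sum_{j:f(j)=k}\mathcal E_j\bigr)_{k\in\Theta'}$. The distance of two instruments over the same $\Theta$ is the diamond norm of the difference of the associated channels $\rho\mapsto\sum_j\mathcal E_j(\rho)\otimes|j\rangle\langle j|$; convergence and closure (inside the set of all instruments over $\Theta$) refer to this distance. An instrument $(\mathcal F_j)_j$ is *one-way local* if either every $\mathcal F_j$ has the form $\mathcal E_j^{A}\otimes\mathcal T_j^{B}$, or every $\mathcal F_j$ has the form $\mathcal T_j^{A}\otimes\mathcal E_j^{B}$, with $\mathcal E_j$ CP and $\mathcal T_j$ trace-preserving CP. An instrument $\mathfrak J'$ is *LOCC linked* to $\mathfrak J=(\mathcal A_j)_j$ if there are one-way local instruments $(\mathcal B_{i|j})_i$, one for each $j$ (the acting party may depend on $j$), such that $\mathfrak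 J'$ is a coarse-graining of $(\mathcal B_{i|j}\circ\mathcal A_j)_{i,j}$. Then $\mathrm{LOCC}_1$ consists of the coarse-grainings of one-way local instruments; for $r\ge2$, $\mathrm{LOCC}_r$ consists of the instruments that are LOCC linked to some instrument in $\mathrm{LOCC}_{r-1}$; and $\mathrm{LOCC}_{\mathbb N}=\bigcup_{r\ge1}\mathrm{LOCC}_r$. An instrument $\mathfrak J$ is in $\mathrm{LOCC}$ if there is a sequence $\mathfrak J_1,\mathfrak J_2,\dots$ in $\mathrm{LOCC}_{\mathbb N}$ (with possibly varying index sets) such that $\mathfrak J_{\nu+1}$ is LOCC linked to $\mathfrak J_\nu$ for every $\nu$, and such that each $\mathfrak J_\nu$ has a coarse-graining $\mathfrak J'_\nu$ over the index set of $\mathfrak J$ with $\mathfrak J'_\nu\to\mathfrak J$. An instrument is *separable* if each of its maps $\mathcal E_j$, extended by the identity on arbitrary finite-dimensional ancillas $A',B'$, maps (unnormalized) states separable with respect to $A'A:B'B$ to such states. **Theorem.** On two qubits let $\mathfrak J=(\mathcal E_{00},\mathcal E_{01},\mathcal E_{10})$, where $$\mathcal E_{00}(\rho)=|11\rangle\langle11|\,\rho\,|11\rangle\langle11|,$$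 $$\mathcal E_{01}(\rho)=\sum_{i=1}^2\bigl(T_i\otimes|0\rangle\langle0|\bigr)\rho\bigl(T_i^\dagger\otimes|0\rangle\langle0|\bigr),\qquad \mathcal E_{10}(\rho)=\sum_{i=1}^2\bigl(|0\rangle\langle0|\otimes T_i\bigr)\rho\bigl(|0\rangle\langle0|\otimes T_i^\dagger\bigr),$$ $$T_1=\begin{pmatrix}\tfrac1{\sqrt3}&0\\0&\tfrac1{\sqrt3}\end{pmatrix},\qquad T_2=\begin{pmatrix}\tfrac1{\sqrt6}&0\\0&\sqrt{\tfrac23}\end{pmatrix}.$$ Then $\mathfrak J$ is a separable instrument. It lies in the closure of $\mathrm{LOCC}$ and in the closure of $\mathrm{LOCC}_{\mathbb N}$, and these two closures, taken in the set of two-qubit instruments with three outcomes, coincide. However, $\mathfrak J\notin\mathrm{LOCC}$. In particular, the set of two-qubit $\mathrm{LOCC}$ instruments with three outcomes is not closed. -/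

import Mathlib

open Filter Topology
open scoped Matrix Kronecker ComplexOrder

namespace LOCC

noncomputable section

/-! ### Superoperators -/

/-- Linear maps on the operators of a finite-dimensional Hilbert space with orthonormal basis
indexed by `n`. -/
abbrev SuperOp (n : Type) : Type := Matrix n n ℂ →ₗ[ℂ] Matrix n n ℂ

/-- The tensor product `Φ ⊗ Ψ` of two superoperators, given by letting `Ψ` act on the second
pair of indices and `Φ` on the first pair. -/
def tensorMap {a b : Type} (Φ : SuperOp a) (Ψ : SuperOp b) : SuperOp (a × b) where
  toFun X := Matrix.of fun p q =>
    Φ (Matrix.of fun i j => Ψ (Matrix.of fun k l => X (i, k) (j, l)) p.2 q.2) p.1 q.1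
  map_add' X Y := by
    ext p q
    have h1 : ∀ i j, (Matrix.of fun k l => (X + Y) (i, k) (j, l))
        = (Matrix.of fun k l => X (i, k) (j, l)) + (Matrix.of fun k l => Y (i, k) (j, l)) :=
      fun i j => rfl
    have h2 : (Matrix.of fun i j => Ψ (Matrix.of fun k l => (X + Y) (i, k) (j, l)) p.2 q.2)
        = (Matrix.of fun i j => Ψ (Matrix.of fun k l => X (i, k) (j, l)) p.2 q.2)
          + (Matrix.of fun i j => Ψ (Matrix.of fun k l => Y (i, k) (j, l)) p.2 q.2) := by
      ext i j
      rw [Matrix.of_apply, h1, map_add]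
      rfl
    rw [Matrix.of_apply, h2, map_add]
    rfl
  map_smul' c X := by
    ext p q
    have h1 : ∀ i j, (Matrix.of fun k l => (c • X) (i, k) (j, l))
        = c • (Matrix.of fun k l => X (i, k) (j, l)) := fun i j => rfl
    have h2 : (Matrix.of fun i j => Ψ (Matrix.of fun k l => (c • X) (i, k) (j, l)) p.2 q.2)
        = c • (Matrix.of fun i j => Ψ (Matrix.of fun k l => X (i, k) (j, l)) p.2 q.2) := by
      ext i j
      rw [Matrix.of_apply, h1, map_smul]
      rfl
    rw [Matrix.of_apply, h2, map_smul]
    rfl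

/-- `tensorMap Φ Ψ` acts on elementary tensors as it should (which determines it). -/
theorem tensorMap_kronecker {a b : Type} (Φ : SuperOp a) (Ψ : SuperOp b)
    (A : Matrix a a ℂ) (B : Matrix b b ℂ) : tensorMap Φ Ψ (A ⊗ₖ B) = Φ A ⊗ₖ Ψ B := by
  ext p q
  have h1 : ∀ i j, (Matrix.of fun k l => (A ⊗ₖ B) (i, k) (j, l)) = A i j • B := by
    intro i j
    ext k l
    simp [Matrix.kroneckerMap_apply]
  have h2 : (Matrix.of fun i j => Ψ (Matrix.of fun k l => (A ⊗ₖ B) (i, k) (j, l)) p.2 q.2)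
      = Ψ B p.2 q.2 • A := by
    ext i j
    simp only [Matrix.of_apply, h1, map_smul, Matrix.smul_apply, smul_eq_mul]
    ring
  change Φ (Matrix.of fun i j =>
    Ψ (Matrix.of fun k l => (A ⊗ₖ B) (i, k) (j, l)) p.2 q.2) p.1 q.1 = _
  rw [h2, map_smul, Matrix.smul_apply, smul_eq_mul, Matrix.kroneckerMap_apply, mul_comm]

/-- The map `ρ ↦ M ρ M†` with the single Kraus operator `M`. -/
def krausMap {n : Type} [Fintype n] (M : Matrix n n ℂ) : SuperOp n where
  toFun ρ := M * ρ * Mᴴ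
  map_add' X Y := by rw [mul_add, add_mul]
  map_smul' c X := by rw [Matrix.mul_smul, Matrix.smul_mul, RingHom.id_apply]

/-- Complete positivity: `id_k ⊗ Φ` maps positive semidefinite operators to positive semidefinite
operators, for every dimension `k` of the ancilla. -/
def IsCP {n : Type} [Fintype n] (Φ : SuperOp n) : Prop :=
  ∀ (k : ℕ) (X : Matrix (Fin k × n) (Fin k × n) ℂ),
    X.PosSemidef → (tensorMap LinearMap.id Φ X).PosSemidef

/-- Trace-preserving completely positive maps. -/
def IsTCP {n : Type} [Fintype n] (Φ : SuperOp n) : Prop :=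
  IsCP Φ ∧ ∀ ρ, (Φ ρ).trace = ρ.trace

/-! ### Quantum instruments -/

/-- A family of superoperators over the index set `Θ`. -/
abbrev Family (n Θ : Type) : Type := Θ → SuperOp n

/-- A quantum instrument: a finite or countably infinite family of CP maps whose sum is
trace-preserving. -/
structure IsInstrument {n Θ : Type} [Fintype n] (J : Family n Θ) : Prop where
  countable : Countable Θ
  cp : ∀ j, IsCP (J j)
  summable : ∀ ρ, Summable fun j => J j ρ
  trace_tsum : ∀ ρ, (∑' j, J j ρ).trace = ρ.trace

/-- `J'` is a coarse-graining of `J`: there is a map `f : Θ → Θ'` of index sets such that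
`J' k` is the sum of the `J j` over the cell `f j = k`, for every `k`. -/
def IsCoarseGraining {n Θ Θ' : Type} (J : Family n Θ) (J' : Family n Θ') : Prop :=
  ∃ f : Θ → Θ', ∀ k ρ, HasSum (fun j : {j // f j = k} => J j ρ) (J' k ρ)

/-! ### The diamond-norm distance of instruments -/

/-- The trace norm `tr √(A† A)`, i.e. the sum of the singular values of `A`. -/
def traceNorm {n : Type} [Fintype n] [DecidableEq n] (A : Matrix n n ℂ) : ℝ :=
  ∑ i, Real.sqrt ((Matrix.isHermitian_conjTranspose_mul_self A).eigenvalues i)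

/-- The distance of two instruments, i.e. the diamond norm of the difference `Δ` of the channels
`ρ ↦ ∑ j, J j ρ ⊗ |j⟩⟨j|`: the supremum of `‖(id ⊗ Δ) X‖₁` over the operators `X` of trace norm
at most one on the system together with an ancilla of the same dimension. As
`(id ⊗ Δ) X = ∑ j, (id ⊗ (J j - J' j)) X ⊗ |j⟩⟨j|` is block diagonal, its trace norm is the sum of
the trace norms of the blocks. The value is an extended nonnegative real, so that sums and suprema
are unconditionally meaningful. -/
def instDist {n Θ : Type} [Fintype n] [DecidableEq n] (J J' : Family n Θ) : ENNReal :=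
  ⨆ (X : Matrix (n × n) (n × n) ℂ) (_ : traceNorm X ≤ 1),
    ∑' j, ENNReal.ofReal (traceNorm (tensorMap LinearMap.id (J j - J' j) X))

/-- Convergence of a sequence of instruments. -/
def ConvergesTo {n Θ : Type} [Fintype n] [DecidableEq n]
    (s : ℕ → Family n Θ) (J : Family n Θ) : Prop :=
  Tendsto (fun ν => instDist (s ν) J) atTop (𝓝 0)

/-- The closure, inside the set of all instruments over `Θ`, of a set of instruments with respect to
the diamond-norm distance. -/
def instClosure {n Θ : Type} [Fintype n] [DecidableEq n] (S : Set (Family n Θ)) :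
    Set (Family n Θ) :=
  {J | IsInstrument J ∧ ∃ s : ℕ → Family n Θ, (∀ ν, s ν ∈ S) ∧ ConvergesTo s J}

/-! ### Bipartite LOCC

The Hilbert spaces of Alice and Bob have orthonormal bases indexed by `a` and `b`. -/

section Bipartite

variable {a b : Type} [Fintype a] [Fintype b]

/-- One-way local with respect to Alice: the `j`-th map is a CP map of Alice tensored with a TCP map
of Bob that may depend on `j`. -/
def OneWayLocalA {Θ : Type} (F : Family (a × b) Θ) : Prop :=
  IsInstrument F ∧ ∀ j, ∃ (E : SuperOp a) (T : SuperOp b),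
    IsCP E ∧ IsTCP T ∧ F j = tensorMap E T

/-- One-way local with respect to Bob. -/
def OneWayLocalB {Θ : Type} (F : Family (a × b) Θ) : Prop :=
  IsInstrument F ∧ ∀ j, ∃ (T : SuperOp a) (E : SuperOp b),
    IsTCP T ∧ IsCP E ∧ F j = tensorMap T E

/-- One-way local with respect to one of the two parties. -/
def OneWayLocal {Θ : Type} (F : Family (a × b) Θ) : Prop :=
  OneWayLocalA F ∨ OneWayLocalB F

/-- `J'` is LOCC linked to `J`: conditioned on the outcome `j` of `J` a one-way local instrument
`B j` (with its own index set and acting party) is applied, followed by a coarse-graining. -/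
def LinkedTo {Θ Θ' : Type} (J' : Family (a × b) Θ') (J : Family (a × b) Θ) : Prop :=
  ∃ (I : Θ → Type) (B : ∀ j, Family (a × b) (I j)),
    (∀ j, OneWayLocal (B j)) ∧
    IsCoarseGraining (fun p : (Σ j, I j) => B p.1 p.2 ∘ₗ J p.1) J'

variable (a b) in
/-- `LOCCRounds a b r Θ` is the set of instruments over `Θ` that can be implemented in `r` rounds,
for `r ≥ 1`. -/
def LOCCRounds : ℕ → (Θ : Type) → Set (Family (a × b) Θ)
  | 0, _ => ∅
  | 1, _ => {J | ∃ (Θ₀ : Type) (F : Family (a × b) Θ₀), OneWayLocal F ∧ IsCoarseGraining F J ∧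
      IsInstrument J}
  | r + 2, _ => {J | ∃ (Θ₀ : Type) (J₀ : Family (a × b) Θ₀), J₀ ∈ LOCCRounds (r + 1) Θ₀ ∧
      LinkedTo J J₀ ∧ IsInstrument J}

variable (a b) in
/-- Finite-round LOCC. -/
def LOCCFin (Θ : Type) : Set (Family (a × b) Θ) :=
  {J | ∃ r, 1 ≤ r ∧ J ∈ LOCCRounds a b r Θ}

variable (a b) in
/-- LOCC, including protocols with an unbounded number of rounds: there is a sequence of finite-round
LOCC instruments, each LOCC linked to its predecessor, having coarse-grainings over `Θ` that
converge to `J`. -/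
def LOCCInst [DecidableEq a] [DecidableEq b] (Θ : Type) : Set (Family (a × b) Θ) :=
  {J | IsInstrument J ∧ ∃ (I : ℕ → Type) (s : ∀ ν, Family (a × b) (I ν)),
    (∀ ν, s ν ∈ LOCCFin a b (I ν)) ∧
    (∀ ν, LinkedTo (s (ν + 1)) (s ν)) ∧
    ∃ s' : ℕ → Family (a × b) Θ,
      (∀ ν, IsInstrument (s' ν) ∧ IsCoarseGraining (s ν) (s' ν)) ∧ ConvergesTo s' J}

/-! ### Separable instruments -/

/-- Separability of a (not necessarily normalized) bipartite state: it is a finite sum of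
tensor products of positive semidefinite operators. -/
def IsSeparableState (ρ : Matrix (a × b) (a × b) ℂ) : Prop :=
  ∃ (m : ℕ) (A : Fin m → Matrix a a ℂ) (B : Fin m → Matrix b b ℂ),
    (∀ i, (A i).PosSemidef) ∧ (∀ i, (B i).PosSemidef) ∧ ρ = ∑ i, A i ⊗ₖ B i

/-- The operator `(id_{A'B'} ⊗ E) ρ` for an operator `ρ` on `(A' A) (B' B)` and a superoperator `E`
on `A B`, again as an operator on `(A' A) (B' B)`. -/
def applyWithAncillas {a b a' b' : Type} (E : SuperOp (a × b))
    (ρ : Matrix ((a' × a) × (b' × b)) ((a' × a) × (b' × b)) ℂ) :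
    Matrix ((a' × a) × (b' × b)) ((a' × a) × (b' × b)) ℂ :=
  (Matrix.reindex (Equiv.prodProdProdComm a' a b' b) (Equiv.prodProdProdComm a' a b' b)).symm
    (tensorMap LinearMap.id E
      (Matrix.reindex (Equiv.prodProdProdComm a' a b' b) (Equiv.prodProdProdComm a' a b' b) ρ))

/-- A separable map: with arbitrary local ancillas `A'`, `B'` it maps states that are separable with
respect to `A'A : B'B` to such states. -/
def IsSeparableMap (E : SuperOp (a × b)) : Prop :=
  ∀ (a' b' : Type) [Fintype a'] [Fintype b']
    (ρ : Matrix ((a' × a) × (b' × b)) ((a' × a) × (b' × b)) ℂ),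
    IsSeparableState ρ → IsSeparableState (applyWithAncillas E ρ)

variable (a b) in
/-- Separable instruments. -/
def SEP (Θ : Type) : Set (Family (a × b) Θ) :=
  {J | IsInstrument J ∧ ∀ j, IsSeparableMap (J j)}

end Bipartite

/-! ### The two-qubit instrument -/

/-- The projector `|0⟩⟨0|`. -/
def P0 : Matrix (Fin 2) (Fin 2) ℂ := !![1, 0; 0, 0]

/-- The projector `|1⟩⟨1|`. -/
def P1 : Matrix (Fin 2) (Fin 2) ℂ := !![0, 0; 0, 1]

def T1 : Matrix (Fin 2) (Fin 2) ℂ :=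
  !![((1 / Real.sqrt 3 : ℝ) : ℂ), 0; 0, ((1 / Real.sqrt 3 : ℝ) : ℂ)]

def T2 : Matrix (Fin 2) (Fin 2) ℂ :=
  !![((1 / Real.sqrt 6 : ℝ) : ℂ), 0; 0, ((Real.sqrt (2 / 3) : ℝ) : ℂ)]

/-- `ρ ↦ |11⟩⟨11| ρ |11⟩⟨11|`. -/
def E00 : SuperOp (Fin 2 × Fin 2) := krausMap (P1 ⊗ₖ P1)

def E01 : SuperOp (Fin 2 × Fin 2) := krausMap (T1 ⊗ₖ P0) + krausMap (T2 ⊗ₖ P0)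

def E10 : SuperOp (Fin 2 × Fin 2) := krausMap (P0 ⊗ₖ T1) + krausMap (P0 ⊗ₖ T2)

/-- The instrument `(E00, E01, E10)`. -/
def targetInstrument : Family (Fin 2 × Fin 2) (Fin 3) := ![E00, E01, E10]

end

end LOCC

/-!
# A separable two-qubit instrument in the closure of LOCC, but not in LOCC

The target instrument is the limit of a protocol in which Alice and Bob alternately apply the weak
filter `diag(u, 1)`. Whoever fails is projected onto `|0⟩`, which ends the protocol. Along the grid
`u = 1 - i / N` (`protocol`, `grid`) every failure of one party leaves the other one with
the operator `diag(u, 1)`, and the resulting Schur multipliers converge to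
`∫₀¹ (t, √t; √t, 1) dt = (1/2, 2/3; 2/3, 1)`, which is what `T1` and `T2` add up to
(`convergesTo_protocol`).

That no LOCC instrument attains the limit is shown with a monotone. Every finite-round LOCC instrument
has Kraus operators `A ⊗ B`, indexed by the leaves of the protocol tree (`IsKrausRep`). With the triangular
factors `(α, γ; 0, β)` of `A` and `(α', γ'; 0, β')` of `B`, put `x = α α'`, `y = β α'`, `z = α β'`
and let the value of `A ⊗ B` be `x (max y z + (min y z)² / (3 max y z))`. This bounds the coherence
that further LOCC operations can extract. It has two properties.

* It does not increase on average under local measurements, because as a function of `α²` and `β²`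
  it is concave, and under the measurement the sum of `α²` is kept and the sum of `β²` does not
  increase (`exists_val_tangent`, `IsMeasurement.tsum_value_le`).
* At multiples of local unitaries it strictly decreases, unless all outcomes are multiples of local
  unitaries again: there `y = z`, and the tangent at this point touches only on one side
  (`IsMeasurement.conformalPair_or_lt`).

A linear functional of instruments, `coherence`, is bounded by the total value of any such family
of Kraus operators. It equals `4 / 3` at the target, which is the value of the identity. So a
sequence of linked instruments whose coarse-grainings converge to the target can never lose value.
Hence all its Kraus operators are multiples of local unitaries, but then the functional is at most
`1` (`targetInstrument_notMem_LOCCInst`).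

The distance of instruments induces the topology of matrix entries when there are finitely many
outcomes (`mem_instClosure_iff`). As LOCC lies between finite-round LOCC and its closure, both
have the same closure (`instClosure_LOCCInst`).
-/

namespace LOCC

noncomputable section

/-! ### The value of a pair of Kraus operators -/

/-- The coherence that can still be extracted from an unnormalized state with amplitudes `y` and `z`
on the two excitations, per unit amplitude of the reference component: the symmetric
function `max + min² / (3 max)`. It is `0` at `y = z = 0`. -/
def gain (y z : ℝ) : ℝ := if z ≤ y then y + z ^ 2 / (3 * y) else z + y ^ 2 / (3 * z)

theorem gain_of_le {y z : ℝ} (h : z ≤ y) : gain y z = y + z ^ 2 / (3 * y) := if_pos h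

theorem gain_of_ge {y z : ℝ} (h : y ≤ z) : gain y z = z + y ^ 2 / (3 * z) := by
  rcases h.eq_or_lt with rfl | h
  · exact if_pos le_rfl
  · exact if_neg h.not_ge

theorem gain_comm (y z : ℝ) : gain y z = gain z y := by
  rcases le_total y z with h | h
  · rw [gain_of_ge h, gain_of_le h]
  · rw [gain_of_le h, gain_of_ge h]

theorem le_gain {y z : ℝ} (hy : 0 ≤ y) (hz : 0 ≤ z) : y ≤ gain y z := by
  rcases le_total y z with h | h
  · rw [gain_of_ge h]
    have : 0 ≤ y ^ 2 / (3 * z) := by positivity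
    linarith
  · rw [gain_of_le h]
    have : 0 ≤ z ^ 2 / (3 * y) := by positivity
    linarith

theorem gain_nonneg {y z : ℝ} (hy : 0 ≤ y) (hz : 0 ≤ z) : 0 ≤ gain y z := hy.trans (le_gain hy hz)

theorem gain_mul {c y z : ℝ} (hc : 0 < c) : gain (c * y) (c * z) = c * gain y z := by
  unfold gain
  simp only [mul_le_mul_iff_right₀ hc]
  split_ifs
  · rw [mul_add, show (c * z) ^ 2 / (3 * (c * y)) = (c * (c * z ^ 2)) / (c * (3 * y)) by ring,
      mul_div_mul_left _ _ hc.ne', mul_div_assoc]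
  · rw [mul_add, show (c * y) ^ 2 / (3 * (c * z)) = (c * (c * y ^ 2)) / (c * (3 * z)) by ring,
      mul_div_mul_left _ _ hc.ne', mul_div_assoc]

/-- As a function of `w ^ 2`, `gain w 1` lies below each of its tangents. The
tangent with parameter `s` touches at `w = s⁻¹`, and at all `w ≤ 1` when `s = 1`. -/
theorem gain_one_le {w s : ℝ} (hw : 0 ≤ w) (hs : 0 < s) (hs1 : s ≤ 1) :
    gain w 1 ≤ (1 / s + s) / 2 + w ^ 2 * ((3 * s - s ^ 3) / 6) := by
  rcases le_total w 1 with h | h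
  · rw [gain_of_ge h]
    have key : 0 ≤ 3 * (1 - s) ^ 2 - w ^ 2 * (s * (1 - s) ^ 2 * (s + 2)) := by
      have h1 : w ^ 2 ≤ 1 := by nlinarith
      have h2 : s * (s + 2) ≤ 3 := by nlinarith
      have h3 : w ^ 2 * (s * (s + 2)) ≤ 1 * 3 :=
        mul_le_mul h1 h2 (by positivity) zero_le_one
      nlinarith [mul_nonneg (sub_nonneg.2 h3) (sq_nonneg (1 - s))]
    have : (1 / s + s) / 2 + w ^ 2 * ((3 * s - s ^ 3) / 6) - (1 + w ^ 2 / (3 * 1))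
        = (3 * (1 - s) ^ 2 - w ^ 2 * (s * (1 - s) ^ 2 * (s + 2))) / (6 * s) := by
      field_simp
      ring
    have h0 := div_nonneg key (by positivity : 0 ≤ 6 * s)
    linarith
  · rw [gain_of_le h]
    have hw0 : 0 < w := by linarith
    have key : 0 ≤ (w * s - 1) ^ 2 * (w * (3 - s ^ 2) - 2 * s) := by
      have h1 : s ^ 2 ≤ 1 := by nlinarith
      refine mul_nonneg (sq_nonneg _) ?_
      nlinarith
    have : (1 / s + s) / 2 + w ^ 2 * ((3 * s - s ^ 3) / 6) - (w + 1 ^ 2 / (3 * w))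
        = (w * s - 1) ^ 2 * (w * (3 - s ^ 2) - 2 * s) / (6 * w * s) := by
      field_simp
      ring
    have h0 := div_nonneg key (by positivity : 0 ≤ 6 * w * s)
    linarith

/-- The tangent with parameter `s = 1` touches only at `w ≤ 1`. -/
theorem gain_one_lt {w : ℝ} (hw : 1 < w) : gain w 1 < 1 + w ^ 2 / 3 := by
  rw [gain_of_le hw.le]
  have hw0 : 0 < w := by linarith
  have : 1 + w ^ 2 / 3 - (w + 1 ^ 2 / (3 * w)) = (w - 1) ^ 3 / (3 * w) := by
    field_simp
    ring
  have h0 : 0 < (w - 1) ^ 3 / (3 * w) := div_pos (pow_pos (by linarith) 3) (by linarith)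
  linarith

/-- The value of a product Kraus operator with invariants `(a, b)` for Alice and `(c, d)` for Bob
(see `leadNorm` and `tailNorm`). -/
def val (a b c d : ℝ) : ℝ := a * c * gain (b * c) (a * d)

theorem val_comm (a b c d : ℝ) : val a b c d = val c d a b := by
  rw [val, val, gain_comm, mul_comm a c, mul_comm a d, mul_comm b c]

theorem val_nonneg {a b c d : ℝ} (ha : 0 ≤ a) (hb : 0 ≤ b) (hc : 0 ≤ c) (hd : 0 ≤ d) :
    0 ≤ val a b c d :=
  mul_nonneg (mul_nonneg ha hc) (gain_nonneg (mul_nonneg hb hc) (mul_nonneg ha hd))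

theorem val_eq_gain_one {a b c d : ℝ} (ha : 0 < a) (hd : 0 < d) :
    val a b c d = a ^ 2 * (c * d) * gain (b * c / (a * d)) 1 := by
  have h : 0 < a * d := mul_pos ha hd
  have := gain_mul (y := b * c / (a * d)) (z := 1) h
  rw [mul_div_cancel₀ _ h.ne', mul_one] at this
  rw [val, this]
  ring

theorem val_le_tangent {a b c d s : ℝ} (ha : 0 ≤ a) (hb : 0 ≤ b) (hc : 0 ≤ c) (hd : 0 < d)
    (hs : 0 < s) (hs1 : s ≤ 1) :
    val a b c d ≤ c * d * ((1 / s + s) / 2) * a ^ 2 + c ^ 3 / d * ((3 * s - s ^ 3) / 6) * b ^ 2 := by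
  have h3 : 0 ≤ 3 * s - s ^ 3 := by nlinarith [mul_nonneg hs.le (sub_nonneg.2 hs1), sq_nonneg s]
  rcases ha.eq_or_lt with rfl | ha
  · have : val 0 b c d = 0 := by simp [val]
    rw [this]
    positivity
  rw [val_eq_gain_one ha hd]
  calc a ^ 2 * (c * d) * gain (b * c / (a * d)) 1
      ≤ a ^ 2 * (c * d) * ((1 / s + s) / 2 + (b * c / (a * d)) ^ 2 * ((3 * s - s ^ 3) / 6)) := by
        gcongr
        exact gain_one_le (by positivity) hs hs1
    _ = _ := by
        field_simp

/-- The value of Alice's invariants, for fixed invariants of Bob, is concave as a function of their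
squares: it has a supporting linear functional at every point. The two implications exclude the
points where a tangent is vertical. -/
theorem exists_val_tangent {a b c d : ℝ} (ha : 0 ≤ a) (hb : 0 ≤ b) (hc : 0 ≤ c) (hd : 0 ≤ d) :
    ∃ l m : ℝ, 0 ≤ l ∧ 0 ≤ m ∧ l * a ^ 2 + m * b ^ 2 = val a b c d ∧
      ∀ a' b' : ℝ, 0 ≤ a' → 0 ≤ b' → (a = 0 → a' = 0) → (b = 0 → b' = 0) →
        val a' b' c d ≤ l * a' ^ 2 + m * b' ^ 2 := by
  rcases ha.eq_or_lt with rfl | ha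
  · refine ⟨0, 0, le_rfl, le_rfl, by simp [val], fun a' b' _ _ h _ => ?_⟩
    rw [h rfl]
    simp [val]
  rcases hd.eq_or_lt with rfl | hd
  · have hval : ∀ a' b' : ℝ, 0 ≤ b' → val a' b' c 0 = a' * b' * c ^ 2 := by
      intro a' b' hb'
      rw [val, mul_zero, gain_of_le (mul_nonneg hb' hc)]
      ring
    rcases hb.eq_or_lt with rfl | hb
    · refine ⟨0, 0, le_rfl, le_rfl, by simp [hval], fun a' b' _ _ _ h => ?_⟩
      rw [h rfl]
      simp [hval]
    -- For `d = 0` the value is `a b c²`, and the tangent is the inequality of the arithmetic and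
    -- geometric means.
    · refine ⟨c ^ 2 * b / (2 * a), c ^ 2 * a / (2 * b), by positivity, by positivity, ?_,
        fun a' b' _ hb' _ _ => ?_⟩
      · rw [hval _ _ hb.le]
        field_simp
        norm_num
      · rw [hval _ _ hb']
        have : c ^ 2 * b / (2 * a) * a' ^ 2 + c ^ 2 * a / (2 * b) * b' ^ 2 - a' * b' * c ^ 2
            = c ^ 2 * (b * a' - a * b') ^ 2 / (2 * a * b) := by
          field_simp
          ring
        have h0 : 0 ≤ c ^ 2 * (b * a' - a * b') ^ 2 / (2 * a * b) := by positivity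
        linarith
  rcases le_total (b * c) (a * d) with h | h
  · refine ⟨c * d * ((1 / 1 + 1) / 2), c ^ 3 / d * ((3 * 1 - 1 ^ 3) / 6), by positivity,
      mul_nonneg (by positivity) (by norm_num), ?_,
      fun a' b' ha' hb' _ _ => val_le_tangent ha' hb' hc hd one_pos le_rfl⟩
    rw [val, gain_of_ge h]
    field_simp
    ring
  · have hbc : 0 < b * c := (mul_pos ha hd).trans_le h
    have hb0 : 0 < b := hb.lt_of_ne' (by rintro rfl; simp at hbc)
    have hc0 : 0 < c := hc.lt_of_ne' (by rintro rfl; simp at hbc)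
    have hs1 : a * d / (b * c) ≤ 1 := (div_le_one hbc).2 h
    have hs : 0 < a * d / (b * c) := by positivity
    refine ⟨_, _, by positivity, mul_nonneg (by positivity) ?_, ?_,
      fun a' b' ha' hb' _ _ => val_le_tangent ha' hb' hc hd hs hs1⟩
    · have : (a * d / (b * c)) ^ 3 ≤ a * d / (b * c) := by
        calc (a * d / (b * c)) ^ 3 ≤ (a * d / (b * c)) ^ 1 :=
              pow_le_pow_of_le_one hs.le hs1 (by norm_num)
          _ = _ := pow_one _
      linarith
    · rw [val, gain_of_le h]
      field_simp
      ring

/-- When Bob's two invariants are both equal to `c`, a tangent is given by `c² (a² + b² / 3)`. -/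
theorem val_le_symm {a b c : ℝ} (ha : 0 ≤ a) (hb : 0 ≤ b) (hc : 0 < c) :
    val a b c c ≤ c ^ 2 * (a ^ 2 + b ^ 2 / 3) := by
  have := val_le_tangent ha hb hc.le hc one_pos le_rfl
  have e : c * c * ((1 / 1 + 1) / 2) * a ^ 2 + c ^ 3 / c * ((3 * 1 - 1 ^ 3) / 6) * b ^ 2
      = c ^ 2 * (a ^ 2 + b ^ 2 / 3) := by
    field_simp
    ring
  linarith

theorem val_lt_symm {a b c : ℝ} (ha : 0 ≤ a) (hc : 0 < c) (hab : a < b) :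
    val a b c c < c ^ 2 * (a ^ 2 + b ^ 2 / 3) := by
  rcases ha.eq_or_lt with rfl | ha
  · have : val 0 b c c = 0 := by simp [val]
    rw [this]
    positivity
  have hw : 1 < b * c / (a * c) := by
    rw [mul_div_mul_right _ _ hc.ne', one_lt_div ha]
    exact hab
  rw [val_eq_gain_one ha hc]
  calc a ^ 2 * (c * c) * gain (b * c / (a * c)) 1
      < a ^ 2 * (c * c) * (1 + (b * c / (a * c)) ^ 2 / 3) := by
        gcongr
        exact gain_one_lt hw
    _ = _ := by
        field_simp

/-! ### Invariants of Kraus operators on a qubit -/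

/-- The squared Euclidean norm of a vector in `ℂ²`. -/
def nsq (v : Fin 2 → ℂ) : ℝ := Complex.normSq (v 0) + Complex.normSq (v 1)

theorem nsq_nonneg (v : Fin 2 → ℂ) : 0 ≤ nsq v :=
  add_nonneg (Complex.normSq_nonneg _) (Complex.normSq_nonneg _)

theorem nsq_eq_zero {v : Fin 2 → ℂ} : nsq v = 0 ↔ v = 0 := by
  constructor
  · intro h
    have h0 := Complex.normSq_nonneg (v 0)
    have h1 := Complex.normSq_nonneg (v 1)
    have e0 : Complex.normSq (v 0) = 0 := by unfold nsq at h; linarith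
    have e1 : Complex.normSq (v 1) = 0 := by unfold nsq at h; linarith
    ext i
    fin_cases i
    · exact Complex.normSq_eq_zero.1 e0
    · exact Complex.normSq_eq_zero.1 e1
  · rintro rfl
    simp [nsq]

theorem nsq_zero : nsq 0 = 0 := nsq_eq_zero.2 rfl

/-- Lagrange's identity for the columns of a matrix. -/
theorem normSq_det_add (A : Matrix (Fin 2) (Fin 2) ℂ) :
    Complex.normSq A.det + Complex.normSq (star (A 0 0) * A 0 1 + star (A 1 0) * A 1 1)
      = nsq (A *ᵥ ![1, 0]) * nsq (A *ᵥ ![0, 1]) := by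
  simp [nsq, Matrix.det_fin_two, Matrix.mulVec, dotProduct, Fin.sum_univ_two, Complex.normSq_apply]
  ring

/-- Lagrange's identity after the column operation that subtracts `t` times the first column from the
second one. -/
theorem normSq_det_add_shear (A : Matrix (Fin 2) (Fin 2) ℂ) (t : ℂ) :
    Complex.normSq A.det
        + Complex.normSq (star (A 0 0) * (A 0 1 - t * A 0 0) + star (A 1 0) * (A 1 1 - t * A 1 0))
      = nsq (A *ᵥ ![1, 0]) * nsq (A *ᵥ ![-t, 1]) := by
  have h := normSq_det_add !![A 0 0, A 0 1 - t * A 0 0; A 1 0, A 1 1 - t * A 1 0]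
  have e : (!![A 0 0, A 0 1 - t * A 0 0; A 1 0, A 1 1 - t * A 1 0]).det = A.det := by
    simp [Matrix.det_fin_two]
    ring
  have e1 : !![A 0 0, A 0 1 - t * A 0 0; A 1 0, A 1 1 - t * A 1 0] *ᵥ ![1, 0]
      = A *ᵥ ![1, 0] := by
    ext i
    fin_cases i <;> simp [Matrix.mulVec, dotProduct, Fin.sum_univ_two]
  have e2 : !![A 0 0, A 0 1 - t * A 0 0; A 1 0, A 1 1 - t * A 1 0] *ᵥ ![0, 1]
      = A *ᵥ ![-t, 1] := by
    ext i
    fin_cases i <;> simp [Matrix.mulVec, dotProduct, Fin.sum_univ_two] <;> ring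
  rwa [e, e1, e2] at h

theorem normSq_det_le (A : Matrix (Fin 2) (Fin 2) ℂ) (t : ℂ) :
    Complex.normSq A.det ≤ nsq (A *ᵥ ![1, 0]) * nsq (A *ᵥ ![-t, 1]) := by
  rw [← normSq_det_add_shear]
  exact le_add_of_nonneg_right (Complex.normSq_nonneg _)

theorem exists_normSq_det_eq {A : Matrix (Fin 2) (Fin 2) ℂ} (hA : nsq (A *ᵥ ![1, 0]) ≠ 0) :
    ∃ t : ℂ, Complex.normSq A.det = nsq (A *ᵥ ![1, 0]) * nsq (A *ᵥ ![-t, 1]) := by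
  -- The best `t` makes the second column orthogonal to the first.
  refine ⟨(star (A 0 0) * A 0 1 + star (A 1 0) * A 1 1) / (nsq (A *ᵥ ![1, 0]) : ℝ), ?_⟩
  set t := (star (A 0 0) * A 0 1 + star (A 1 0) * A 1 1) / (nsq (A *ᵥ ![1, 0]) : ℝ) with ht
  have hn : ((nsq (A *ᵥ ![1, 0]) : ℝ) : ℂ) = star (A 0 0) * A 0 0 + star (A 1 0) * A 1 0 := by
    simp [nsq, Matrix.mulVec, dotProduct, Fin.sum_univ_two, Complex.normSq_eq_conj_mul_self]
  have hn0 : ((nsq (A *ᵥ ![1, 0]) : ℝ) : ℂ) ≠ 0 := by exact_mod_cast hA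
  have e3 : star (A 0 0) * (A 0 1 - t * A 0 0) + star (A 1 0) * (A 1 1 - t * A 1 0) = 0 := by
    have : t * ((nsq (A *ᵥ ![1, 0]) : ℝ) : ℂ)
        = star (A 0 0) * A 0 1 + star (A 1 0) * A 1 1 := by
      rw [ht, div_mul_cancel₀ _ hn0]
    rw [hn] at this
    linear_combination -this
  rw [← normSq_det_add_shear, e3, map_zero, add_zero]

/-- The norm of the first column of `A`, i.e. the entry `α` of the triangular factor
`(α, γ; 0, β)` of `A`. -/
def leadNorm (A : Matrix (Fin 2) (Fin 2) ℂ) : ℝ := √(nsq (A *ᵥ ![1, 0]))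

/-- The distance of the second column of `A` to the line spanned by the first one, i.e. the entry
`β` of the triangular factor `(α, γ; 0, β)` of `A`. It is set to `0` if the first column is zero. -/
def tailNorm (A : Matrix (Fin 2) (Fin 2) ℂ) : ℝ := ‖A.det‖ / leadNorm A

theorem leadNorm_nonneg (A : Matrix (Fin 2) (Fin 2) ℂ) : 0 ≤ leadNorm A := Real.sqrt_nonneg _

theorem tailNorm_nonneg (A : Matrix (Fin 2) (Fin 2) ℂ) : 0 ≤ tailNorm A :=
  div_nonneg (norm_nonneg _) (leadNorm_nonneg _)

theorem leadNorm_sq (A : Matrix (Fin 2) (Fin 2) ℂ) : leadNorm A ^ 2 = nsq (A *ᵥ ![1, 0]) :=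
  Real.sq_sqrt (nsq_nonneg _)

theorem leadNorm_eq_zero {A : Matrix (Fin 2) (Fin 2) ℂ} :
    leadNorm A = 0 ↔ A *ᵥ ![1, 0] = 0 := by
  rw [← nsq_eq_zero, ← leadNorm_sq, sq_eq_zero_iff]

theorem tailNorm_sq_le (A : Matrix (Fin 2) (Fin 2) ℂ) (t : ℂ) :
    tailNorm A ^ 2 ≤ nsq (A *ᵥ ![-t, 1]) := by
  rw [tailNorm, div_pow, leadNorm_sq, ← Complex.normSq_eq_norm_sq]
  exact div_le_of_le_mul₀ (nsq_nonneg _) (nsq_nonneg _) ((normSq_det_le A t).trans_eq (mul_comm _ _))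

theorem exists_tailNorm_sq_eq {A : Matrix (Fin 2) (Fin 2) ℂ} (hA : leadNorm A ≠ 0) :
    ∃ t : ℂ, tailNorm A ^ 2 = nsq (A *ᵥ ![-t, 1]) := by
  have hn : nsq (A *ᵥ ![1, 0]) ≠ 0 := by
    rw [← leadNorm_sq]
    exact pow_ne_zero 2 hA
  obtain ⟨t, ht⟩ := exists_normSq_det_eq hn
  refine ⟨t, ?_⟩
  rw [tailNorm, div_pow, leadNorm_sq, ← Complex.normSq_eq_norm_sq, ht, mul_div_cancel_left₀ _ hn]

theorem leadNorm_mul_tailNorm (A : Matrix (Fin 2) (Fin 2) ℂ) :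
    leadNorm A * tailNorm A = ‖A.det‖ := by
  by_cases h : leadNorm A = 0
  · have h2 := normSq_det_le A 0
    rw [← leadNorm_sq, h] at h2
    have : Complex.normSq A.det = 0 := le_antisymm (by simpa using h2) (Complex.normSq_nonneg _)
    rw [h, Complex.normSq_eq_zero.1 this]
    simp
  · rw [tailNorm, mul_div_cancel₀ _ h]

/-- The value of the product Kraus operator `A ⊗ B`. -/
def value (A B : Matrix (Fin 2) (Fin 2) ℂ) : ℝ :=
  val (leadNorm A) (tailNorm A) (leadNorm B) (tailNorm B)

theorem value_comm (A B : Matrix (Fin 2) (Fin 2) ℂ) : value A B = value B A := val_comm _ _ _ _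

theorem value_nonneg (A B : Matrix (Fin 2) (Fin 2) ℂ) : 0 ≤ value A B :=
  val_nonneg (leadNorm_nonneg _) (tailNorm_nonneg _) (leadNorm_nonneg _) (tailNorm_nonneg _)

/-- `A` is a multiple of an isometry, with ratio `c` of squared norms. -/
def IsConformal (c : ℝ) (A : Matrix (Fin 2) (Fin 2) ℂ) : Prop :=
  ∀ v, nsq (A *ᵥ v) = c * nsq v

theorem IsConformal.nonneg {c : ℝ} {A : Matrix (Fin 2) (Fin 2) ℂ} (h : IsConformal c A) :
    0 ≤ c := by
  have h1 := h ![1, 0]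
  have : nsq ![1, 0] = 1 := by simp [nsq]
  rw [this, mul_one] at h1
  exact h1 ▸ nsq_nonneg _

theorem IsConformal.leadNorm {c : ℝ} {A : Matrix (Fin 2) (Fin 2) ℂ} (h : IsConformal c A) :
    leadNorm A = √c := by
  have : nsq ![1, 0] = 1 := by simp [nsq]
  rw [LOCC.leadNorm, h, this, mul_one]

theorem IsConformal.tailNorm {c : ℝ} {A : Matrix (Fin 2) (Fin 2) ℂ} (h : IsConformal c A) :
    tailNorm A = √c := by
  rcases h.nonneg.eq_or_lt with hc | hc
  · rw [LOCC.tailNorm, h.leadNorm, ← hc]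
    simp
  · obtain ⟨t, ht⟩ := exists_tailNorm_sq_eq (A := A) (by rw [h.leadNorm]; positivity)
    have h1 := tailNorm_sq_le A 0
    rw [h] at h1 ht
    have e0 : nsq ![-0, 1] = 1 := by simp [nsq]
    have et : nsq ![-t, 1] = Complex.normSq t + 1 := by simp [nsq]
    rw [e0] at h1
    rw [et] at ht
    have : LOCC.tailNorm A ^ 2 = c := by nlinarith [Complex.normSq_nonneg t]
    rw [← this, Real.sqrt_sq (tailNorm_nonneg _)]

/-- Equality in the comparison of the tail norm with the second column means orthogonal columns. -/
theorem isConformal_of_eq {A : Matrix (Fin 2) (Fin 2) ℂ}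
    (h1 : tailNorm A ^ 2 = nsq (A *ᵥ ![0, 1])) (h2 : leadNorm A ^ 2 = nsq (A *ᵥ ![0, 1])) :
    IsConformal (leadNorm A ^ 2) A := by
  have h3 : Complex.normSq A.det = nsq (A *ᵥ ![1, 0]) * nsq (A *ᵥ ![0, 1]) := by
    rw [Complex.normSq_eq_norm_sq, ← leadNorm_mul_tailNorm, mul_pow, h1, leadNorm_sq]
  have h4 := normSq_det_add A
  have h5 : star (A 0 0) * A 0 1 + star (A 1 0) * A 1 1 = 0 :=
    Complex.normSq_eq_zero.1 (by linarith)
  intro v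
  have h6 : nsq (A *ᵥ v) = nsq (A *ᵥ ![1, 0]) * Complex.normSq (v 0)
      + nsq (A *ᵥ ![0, 1]) * Complex.normSq (v 1)
      + 2 * (star (v 0) * v 1 * (star (A 0 0) * A 0 1 + star (A 1 0) * A 1 1)).re := by
    simp [nsq, Matrix.mulVec, dotProduct, Fin.sum_univ_two, Complex.normSq_apply]
    ring
  rw [h6, h5, ← h2, ← leadNorm_sq]
  simp [nsq]
  ring

/-! ### Local measurements -/

/-- The completeness relation `∑ M_k† M_k = 1` of the Kraus operators of a measurement, written as
conservation of the total squared norm. -/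
def IsMeasurement {I : Type} (M : I → Matrix (Fin 2) (Fin 2) ℂ) : Prop :=
  ∀ v, HasSum (fun i => nsq (M i *ᵥ v)) (nsq v)

theorem IsMeasurement.mul_right {I : Type} {M : I → Matrix (Fin 2) (Fin 2) ℂ}
    (hM : IsMeasurement M) (A : Matrix (Fin 2) (Fin 2) ℂ) (v : Fin 2 → ℂ) :
    HasSum (fun i => nsq ((M i * A) *ᵥ v)) (nsq (A *ᵥ v)) := by
  simpa only [Matrix.mulVec_mulVec] using hM (A *ᵥ v)

theorem leadNorm_mul_eq_zero {A : Matrix (Fin 2) (Fin 2) ℂ} (M : Matrix (Fin 2) (Fin 2) ℂ)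
    (h : leadNorm A = 0) : leadNorm (M * A) = 0 := by
  rw [leadNorm_eq_zero] at h ⊢
  rw [← Matrix.mulVec_mulVec, h, Matrix.mulVec_zero]

theorem tailNorm_mul_eq_zero {A : Matrix (Fin 2) (Fin 2) ℂ} (M : Matrix (Fin 2) (Fin 2) ℂ)
    (h : tailNorm A = 0) : tailNorm (M * A) = 0 := by
  have : ‖A.det‖ = 0 := by rw [← leadNorm_mul_tailNorm, h, mul_zero]
  rw [tailNorm, Matrix.det_mul, norm_mul, this]
  simp

/-- A local measurement does not increase the value on average. -/
theorem IsMeasurement.tsum_value_le {I : Type} {M : I → Matrix (Fin 2) (Fin 2) ℂ}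
    (hM : IsMeasurement M) (A B : Matrix (Fin 2) (Fin 2) ℂ) :
    ∑' i, ENNReal.ofReal (value (M i * A) B) ≤ ENNReal.ofReal (value A B) := by
  by_cases h : leadNorm A = 0
  · have : ∀ i, value (M i * A) B = 0 := fun i => by
      rw [value, leadNorm_mul_eq_zero _ h]
      simp [val]
    simp [this]
  obtain ⟨l, m, hl, hm, he, hle⟩ := exists_val_tangent (leadNorm_nonneg A) (tailNorm_nonneg A)
    (leadNorm_nonneg B) (tailNorm_nonneg B)
  obtain ⟨t, ht⟩ := exists_tailNorm_sq_eq h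
  have hs : HasSum (fun i => l * nsq ((M i * A) *ᵥ ![1, 0]) + m * nsq ((M i * A) *ᵥ ![-t, 1]))
      (value A B) := by
    rw [value, ← he, leadNorm_sq, ht]
    exact ((hM.mul_right A _).mul_left l).add ((hM.mul_right A _).mul_left m)
  rw [← hs.tsum_eq, ENNReal.ofReal_tsum_of_nonneg _ hs.summable]
  · refine ENNReal.tsum_le_tsum fun i => ENNReal.ofReal_le_ofReal ?_
    refine (hle _ _ (leadNorm_nonneg _) (tailNorm_nonneg _) (leadNorm_mul_eq_zero _)
      (tailNorm_mul_eq_zero _)).trans ?_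
    rw [leadNorm_sq]
    gcongr
    exact tailNorm_sq_le _ _
  · exact fun i => add_nonneg (mul_nonneg hl (nsq_nonneg _)) (mul_nonneg hm (nsq_nonneg _))

/-- Both factors are multiples of isometries, up to pairs one of whose factors vanishes. -/
def IsConformalPair (A B : Matrix (Fin 2) (Fin 2) ℂ) : Prop :=
  ∃ c : ℝ, ∀ v w, nsq (A *ᵥ v) * nsq (B *ᵥ w) = c * (nsq v * nsq w)

theorem IsConformalPair.symm {A B : Matrix (Fin 2) (Fin 2) ℂ} (h : IsConformalPair A B) :
    IsConformalPair B A := by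
  obtain ⟨c, hc⟩ := h
  exact ⟨c, fun v w => by rw [mul_comm, hc, mul_comm (nsq v)]⟩

theorem IsConformalPair.cases {A B : Matrix (Fin 2) (Fin 2) ℂ} (h : IsConformalPair A B) :
    (∀ v w, nsq (A *ᵥ v) * nsq (B *ᵥ w) = 0) ∨
      ∃ c d : ℝ, 0 < c ∧ 0 < d ∧ IsConformal c A ∧ IsConformal d B := by
  obtain ⟨c, hc⟩ := h
  have e1 : nsq ![1, 0] = 1 := by simp [nsq]
  by_cases h0 : c = 0
  · left
    intro v w
    rw [hc, h0, zero_mul]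
  · right
    have h1 := hc ![1, 0] ![1, 0]
    rw [e1, mul_one, mul_one] at h1
    have hA : nsq (A *ᵥ ![1, 0]) ≠ 0 := fun h => h0 (by rw [← h1, h, zero_mul])
    have hB : nsq (B *ᵥ ![1, 0]) ≠ 0 := fun h => h0 (by rw [← h1, h, mul_zero])
    refine ⟨nsq (A *ᵥ ![1, 0]), nsq (B *ᵥ ![1, 0]), (nsq_nonneg _).lt_of_ne' hA,
      (nsq_nonneg _).lt_of_ne' hB, fun v => ?_, fun w => ?_⟩
    · have h2 := hc v ![1, 0]
      rw [e1, mul_one, ← h1] at h2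
      exact mul_right_cancel₀ hB (by linarith)
    · have h2 := hc ![1, 0] w
      rw [e1, one_mul, ← h1] at h2
      exact mul_left_cancel₀ hA (by linarith)

theorem IsConformal.pair {c d : ℝ} {A B : Matrix (Fin 2) (Fin 2) ℂ} (hA : IsConformal c A)
    (hB : IsConformal d B) : IsConformalPair A B :=
  ⟨c * d, fun v w => by rw [hA, hB]; ring⟩

theorem IsConformal.value {c d : ℝ} {A B : Matrix (Fin 2) (Fin 2) ℂ} (hA : IsConformal c A)
    (hB : IsConformal d B) : value A B = 4 / 3 * (c * d) := by
  rw [LOCC.value, hA.leadNorm, hA.tailNorm, hB.leadNorm, hB.tailNorm, val, gain_of_le le_rfl]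
  obtain ⟨hc, hd⟩ := And.intro hA.nonneg hB.nonneg
  have h1 : (√c * √d) * (√c * √d) = c * d := by
    rw [mul_mul_mul_comm, Real.mul_self_sqrt hc, Real.mul_self_sqrt hd]
  have h2 : (√c * √d) ^ 2 / (3 * (√c * √d)) = √c * √d / 3 := by
    rcases (mul_nonneg (Real.sqrt_nonneg c) (Real.sqrt_nonneg d)).eq_or_lt with h | h
    · rw [← h]
      simp
    · field_simp
  rw [h2]
  linear_combination (4 / 3) * h1

/-- At a conformal pair, the only measurements that keep the value are the trivial ones: those whose
Kraus operators are multiples of unitaries. The tangent at equal invariants touches only where the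
tail norm is at most the lead norm, while the squared norms of the two columns have the same
sum over the outcomes, so no outcome can have a strictly smaller tail norm. -/
theorem IsMeasurement.conformalPair_or_lt {I : Type} {M : I → Matrix (Fin 2) (Fin 2) ℂ}
    (hM : IsMeasurement M) {A B : Matrix (Fin 2) (Fin 2) ℂ} (h : IsConformalPair A B) :
    (∀ i, IsConformalPair (M i * A) B) ∨
      ∑' i, ENNReal.ofReal (value (M i * A) B) < ENNReal.ofReal (value A B) := by
  rcases h.cases with h0 | ⟨c, d, hc, hd, hA, hB⟩
  · left
    refine fun i => ⟨0, fun v w => ?_⟩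
    rw [zero_mul]
    rcases mul_eq_zero.1 (h0 v w) with h1 | h1
    · rw [← Matrix.mulVec_mulVec, nsq_eq_zero.1 h1, Matrix.mulVec_zero, nsq_zero, zero_mul]
    · rw [h1, mul_zero]
  set p : I → ℝ := fun i => nsq ((M i * A) *ᵥ ![1, 0]) with hp
  set m : I → ℝ := fun i => nsq ((M i * A) *ᵥ ![0, 1]) with hm
  have e0 : nsq ![1, 0] = 1 := by simp [nsq]
  have e1 : nsq ![0, 1] = 1 := by simp [nsq]
  have hps : HasSum p c := by
    have := hM.mul_right A ![1, 0]
    rwa [hA, e0, mul_one] at this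
  have hms : HasSum m c := by
    have := hM.mul_right A ![0, 1]
    rwa [hA, e1, mul_one] at this
  have hs : HasSum (fun i => d * (p i + m i / 3)) (value A B) := by
    have : value A B = d * (c + c / 3) := by rw [hA.value hB]; ring
    rw [this]
    exact (hps.add (hms.div_const 3)).mul_left d
  have hval : ∀ i, value (M i * A) B = val (leadNorm (M i * A)) (tailNorm (M i * A)) √d √d :=
    fun i => by rw [value, hB.leadNorm, hB.tailNorm]
  have hsd : 0 < √d := Real.sqrt_pos.2 hd
  have htm : ∀ i, tailNorm (M i * A) ^ 2 ≤ m i := fun i => by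
    have := tailNorm_sq_le (M i * A) 0
    rwa [neg_zero] at this
  have hle1 : ∀ i, d * (leadNorm (M i * A) ^ 2 + tailNorm (M i * A) ^ 2 / 3)
      ≤ d * (p i + m i / 3) := fun i => by
    rw [leadNorm_sq]
    gcongr
    exact htm i
  have hle2 : ∀ i, value (M i * A) B
      ≤ d * (leadNorm (M i * A) ^ 2 + tailNorm (M i * A) ^ 2 / 3) := fun i => by
    have := val_le_symm (leadNorm_nonneg (M i * A)) (tailNorm_nonneg (M i * A)) hsd
    rwa [Real.sq_sqrt hd.le, ← hval] at this
  have hnn : ∀ i, 0 ≤ d * (p i + m i / 3) := fun i => by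
    have := nsq_nonneg ((M i * A) *ᵥ ![1, 0])
    have := nsq_nonneg ((M i * A) *ᵥ ![0, 1])
    positivity
  have hsum : ∑' i, ENNReal.ofReal (d * (p i + m i / 3)) = ENNReal.ofReal (value A B) := by
    rw [← ENNReal.ofReal_tsum_of_nonneg hnn hs.summable, hs.tsum_eq]
  by_cases heq : ∀ i, value (M i * A) B = d * (p i + m i / 3)
  · left
    have h1 : ∀ i, tailNorm (M i * A) ^ 2 = m i := fun i => by
      have h2 := (hle2 i).antisymm ((hle1 i).trans_eq (heq i).symm)
      rw [heq i, leadNorm_sq] at h2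
      have h3 := mul_left_cancel₀ hd.ne' h2
      simp only [hp] at h3
      linarith
    have h2 : ∀ i, tailNorm (M i * A) ≤ leadNorm (M i * A) := fun i => by
      by_contra! hlt
      have := val_lt_symm (leadNorm_nonneg (M i * A)) hsd hlt
      rw [Real.sq_sqrt hd.le, ← hval] at this
      exact absurd (this.trans_le (hle1 i)) (by rw [heq i]; exact lt_irrefl _)
    have h3 : ∀ i, 0 ≤ p i - m i := fun i => by
      have := pow_le_pow_left₀ (tailNorm_nonneg _) (h2 i) 2
      rw [h1, leadNorm_sq] at this
      exact sub_nonneg.2 this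
    have h4 : HasSum (fun i => p i - m i) 0 := by simpa using hps.sub hms
    have h5 : ∀ i, p i - m i = 0 := fun i => congrFun ((hasSum_zero_iff_of_nonneg h3).1 h4) i
    intro i
    refine (isConformal_of_eq (h1 i) ?_).pair hB
    rw [leadNorm_sq]
    exact sub_eq_zero.1 (h5 i)
  · right
    push Not at heq
    obtain ⟨i, hi⟩ := heq
    rw [← hsum]
    refine ENNReal.tsum_lt_tsum (i := i) ?_
      (fun j => ENNReal.ofReal_le_ofReal ((hle2 j).trans (hle1 j))) ?_
    · refine ne_top_of_le_ne_top ?_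
        (ENNReal.tsum_le_tsum fun j => ENNReal.ofReal_le_ofReal ((hle2 j).trans (hle1 j)))
      rw [hsum]
      exact ENNReal.ofReal_ne_top
    · have hlt := ((hle2 i).trans (hle1 i)).lt_of_ne hi
      exact (ENNReal.ofReal_lt_ofReal_iff_of_nonneg (value_nonneg _ _)).2 hlt

/-! ### Families of product Kraus operators of a protocol -/

/-- The squared Frobenius norm. -/
def frobSq (A : Matrix (Fin 2) (Fin 2) ℂ) : ℝ := nsq (A *ᵥ ![1, 0]) + nsq (A *ᵥ ![0, 1])

theorem frobSq_nonneg (A : Matrix (Fin 2) (Fin 2) ℂ) : 0 ≤ frobSq A :=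
  add_nonneg (nsq_nonneg _) (nsq_nonneg _)

/-- What the family of Kraus operators `M i ⊗ N i` of a finite-round LOCC protocol satisfies: when
performed after a product operator `A ⊗ B` it neither increases the value nor the squared norm on
average, and it keeps the value at a conformal pair only if all resulting pairs are conformal. -/
structure IsDissipative {I : Type} (M N : I → Matrix (Fin 2) (Fin 2) ℂ) : Prop where
  value_le : ∀ A B, ∑' i, ENNReal.ofReal (value (M i * A) (N i * B)) ≤ ENNReal.ofReal (value A B)
  frobSq_le : ∀ A B, ∑' i, ENNReal.ofReal (frobSq (M i * A) * frobSq (N i * B))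
    ≤ ENNReal.ofReal (frobSq A * frobSq B)
  conformalPair_or_lt : ∀ A B, IsConformalPair A B →
    (∀ i, IsConformalPair (M i * A) (N i * B)) ∨
      ∑' i, ENNReal.ofReal (value (M i * A) (N i * B)) < ENNReal.ofReal (value A B)

theorem IsMeasurement.isDissipative {I : Type} {M : I → Matrix (Fin 2) (Fin 2) ℂ}
    (hM : IsMeasurement M) : IsDissipative M (fun _ => 1) where
  value_le A B := by simpa only [one_mul] using hM.tsum_value_le A B
  frobSq_le A B := by
    have hs : HasSum (fun i => frobSq (M i * A) * frobSq B) (frobSq A * frobSq B) :=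
      ((hM.mul_right A _).add (hM.mul_right A _)).mul_right _
    simp only [one_mul]
    rw [← hs.tsum_eq, ENNReal.ofReal_tsum_of_nonneg
      (fun i => mul_nonneg (frobSq_nonneg _) (frobSq_nonneg _)) hs.summable]
  conformalPair_or_lt A B h := by simpa only [one_mul] using hM.conformalPair_or_lt h

theorem IsDissipative.symm {I : Type} {M N : I → Matrix (Fin 2) (Fin 2) ℂ}
    (h : IsDissipative M N) : IsDissipative N M where
  value_le A B := by simpa only [value_comm] using h.value_le B A
  frobSq_le A B := by
    rw [mul_comm (frobSq A)]
    exact (tsum_congr fun i => by rw [mul_comm]).trans_le (h.frobSq_le B A)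
  conformalPair_or_lt A B hAB := by
    rcases h.conformalPair_or_lt B A hAB.symm with h1 | h1
    · exact Or.inl fun i => (h1 i).symm
    · right
      simpa only [value_comm] using h1

theorem IsDissipative.sigma {I : Type} {J : I → Type} {M N : I → Matrix (Fin 2) (Fin 2) ℂ}
    {M' N' : ∀ i, J i → Matrix (Fin 2) (Fin 2) ℂ} (h : IsDissipative M N)
    (h' : ∀ i, IsDissipative (M' i) (N' i)) :
    IsDissipative (fun x : Sigma J => M' x.1 x.2 * M x.1)
      (fun x : Sigma J => N' x.1 x.2 * N x.1) where
  value_le A B := by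
    simp only [mul_assoc]
    rw [ENNReal.tsum_sigma']
    exact (ENNReal.tsum_le_tsum fun i => (h' i).value_le (M i * A) (N i * B)).trans (h.value_le A B)
  frobSq_le A B := by
    simp only [mul_assoc (M' _ _), mul_assoc (N' _ _)]
    rw [ENNReal.tsum_sigma']
    exact (ENNReal.tsum_le_tsum fun i => (h' i).frobSq_le (M i * A) (N i * B)).trans (h.frobSq_le A B)
  conformalPair_or_lt A B hAB := by
    simp only [mul_assoc]
    rw [ENNReal.tsum_sigma']
    rcases h.conformalPair_or_lt A B hAB with h1 | h1
    · by_cases h2 : ∀ i j, IsConformalPair (M' i j * (M i * A)) (N' i j * (N i * B))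
      · exact Or.inl fun x => h2 x.1 x.2
      · right
        push Not at h2
        obtain ⟨i, j, hij⟩ := h2
        have h3 := ((h' i).conformalPair_or_lt _ _ (h1 i)).resolve_left (fun h4 => hij (h4 j))
        refine (ENNReal.tsum_lt_tsum (i := i) ?_ (fun i => (h' i).value_le (M i * A) (N i * B)) h3).trans_le
          (h.value_le A B)
        exact ne_top_of_le_ne_top ENNReal.ofReal_ne_top
          ((ENNReal.tsum_le_tsum fun i => (h' i).value_le (M i * A) (N i * B)).trans (h.value_le A B))
    · exact Or.inr ((ENNReal.tsum_le_tsum fun i => (h' i).value_le (M i * A) (N i * B)).trans_lt h1)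

theorem IsDissipative.comp_equiv {I I' : Type} {M N : I → Matrix (Fin 2) (Fin 2) ℂ}
    (h : IsDissipative M N) (e : I' ≃ I) :
    IsDissipative (fun i => M (e i)) (fun i => N (e i)) where
  value_le A B := by
    rw [e.tsum_eq (fun i => ENNReal.ofReal (value (M i * A) (N i * B)))]
    exact h.value_le A B
  frobSq_le A B := by
    rw [e.tsum_eq (fun i => ENNReal.ofReal (frobSq (M i * A) * frobSq (N i * B)))]
    exact h.frobSq_le A B
  conformalPair_or_lt A B hAB := by
    rw [e.tsum_eq (fun i => ENNReal.ofReal (value (M i * A) (N i * B)))]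
    exact (h.conformalPair_or_lt A B hAB).imp_left fun h1 i => h1 (e i)

theorem isConformal_one : IsConformal 1 1 := fun v => by simp

theorem isDissipative_one : IsDissipative (fun _ : Unit => 1) (fun _ => 1) where
  value_le A B := by simp
  frobSq_le A B := by simp
  conformalPair_or_lt A B h := Or.inl fun _ => by simpa using h

/-- The total value left over by a family of Kraus operators. -/
def totalValue {I : Type} (M N : I → Matrix (Fin 2) (Fin 2) ℂ) : ENNReal :=
  ∑' i, ENNReal.ofReal (value (M i) (N i))

theorem IsDissipative.totalValue_le {I : Type} {M N : I → Matrix (Fin 2) (Fin 2) ℂ}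
    (h : IsDissipative M N) : totalValue M N ≤ ENNReal.ofReal (4 / 3) := by
  have := h.value_le 1 1
  simpa only [mul_one, isConformal_one.value isConformal_one, totalValue] using this

theorem IsDissipative.conformalPair_or_totalValue_lt {I : Type}
    {M N : I → Matrix (Fin 2) (Fin 2) ℂ} (h : IsDissipative M N) :
    (∀ i, IsConformalPair (M i) (N i)) ∨ totalValue M N < ENNReal.ofReal (4 / 3) := by
  have := h.conformalPair_or_lt 1 1 (isConformal_one.pair isConformal_one)
  simpa only [mul_one, isConformal_one.value isConformal_one, totalValue] using this

theorem IsDissipative.summable {I : Type} {M N : I → Matrix (Fin 2) (Fin 2) ℂ}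
    (h : IsDissipative M N) : Summable fun i => frobSq (M i) * frobSq (N i) := by
  have h1 := ne_top_of_le_ne_top ENNReal.ofReal_ne_top (h.frobSq_le 1 1)
  simp only [mul_one] at h1
  refine (ENNReal.summable_toReal h1).congr fun i => ?_
  exact (ENNReal.toReal_ofReal (mul_nonneg (frobSq_nonneg _) (frobSq_nonneg _)))

theorem totalValue_sigma_le {I : Type} {J : I → Type} (M N : I → Matrix (Fin 2) (Fin 2) ℂ)
    {M' N' : ∀ i, J i → Matrix (Fin 2) (Fin 2) ℂ} (h' : ∀ i, IsDissipative (M' i) (N' i)) :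
    totalValue (fun x : Sigma J => M' x.1 x.2 * M x.1) (fun x : Sigma J => N' x.1 x.2 * N x.1)
      ≤ totalValue M N := by
  rw [totalValue, ENNReal.tsum_sigma']
  exact ENNReal.tsum_le_tsum fun i => (h' i).value_le (M i) (N i)

/-! ### Kraus decompositions -/

theorem krausMap_apply {n : Type} [Fintype n] (M ρ : Matrix n n ℂ) :
    krausMap M ρ = M * ρ * Mᴴ := rfl

theorem tensorMap_id_apply {k n : Type} (Φ : SuperOp n) (X : Matrix (k × n) (k × n) ℂ)
    (i j : k) (p q : n) :
    tensorMap LinearMap.id Φ X (i, p) (j, q)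
      = Φ (Matrix.of fun r s => X (i, r) (j, s)) p q := rfl

/-- Superoperators are determined by their values on product operators. -/
theorem superOp_ext_kronecker {a b : Type} [Fintype a] [Fintype b] [DecidableEq a] [DecidableEq b]
    {Φ Ψ : SuperOp (a × b)} (h : ∀ A B, Φ (A ⊗ₖ B) = Ψ (A ⊗ₖ B)) : Φ = Ψ := by
  refine LinearMap.ext fun X => ?_
  rw [Matrix.matrix_eq_sum_single X]
  simp only [map_sum]
  refine Finset.sum_congr rfl fun p _ => Finset.sum_congr rfl fun q _ => ?_
  have : Matrix.single p q (X p q)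
      = Matrix.single p.1 q.1 (X p q) ⊗ₖ Matrix.single p.2 q.2 (1 : ℂ) := by
    rw [Matrix.single_kronecker_single, mul_one]
  rw [this, h]

theorem krausMap_kronecker {a b : Type} [Fintype a] [Fintype b] (M A : Matrix a a ℂ)
    (N B : Matrix b b ℂ) : krausMap (M ⊗ₖ N) (A ⊗ₖ B) = krausMap M A ⊗ₖ krausMap N B := by
  simp only [krausMap_apply, Matrix.conjTranspose_kronecker, Matrix.mul_kronecker_mul]

theorem tensorMap_sum_krausMap {a b r s : Type} [Fintype a] [Fintype b] [DecidableEq a]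
    [DecidableEq b] [Fintype r] [Fintype s] (M : r → Matrix a a ℂ) (N : s → Matrix b b ℂ) :
    tensorMap (∑ x, krausMap (M x)) (∑ y, krausMap (N y))
      = ∑ z : r × s, krausMap (M z.1 ⊗ₖ N z.2) := by
  refine superOp_ext_kronecker fun A B => ?_
  rw [tensorMap_kronecker, LinearMap.sum_apply, LinearMap.sum_apply, LinearMap.sum_apply,
    Fintype.sum_prod_type]
  simp only [krausMap_kronecker]
  ext p q
  simp only [Matrix.kroneckerMap_apply, Matrix.sum_apply, Finset.sum_mul_sum]

open scoped MatrixOrder Matrix.Norms.L2Operator in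
theorem exists_eq_conjTranspose_mul_self {n : Type} [Fintype n] [DecidableEq n]
    {X : Matrix n n ℂ} (h : X.PosSemidef) : ∃ B : Matrix n n ℂ, X = Bᴴ * B :=
  CStarAlgebra.nonneg_iff_eq_star_mul_self.1 h.nonneg

/-- The Kraus decomposition of a completely positive map on a qubit, read off a
factorization of its Choi matrix. -/
theorem IsCP.exists_krausMap {Φ : SuperOp (Fin 2)} (h : IsCP Φ) :
    ∃ M : Fin 2 × Fin 2 → Matrix (Fin 2) (Fin 2) ℂ, Φ = ∑ r, krausMap (M r) := by
  set w : Fin 2 × Fin 2 → ℂ := fun x => if x.1 = x.2 then 1 else 0 with hw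
  obtain ⟨B, hB⟩ := exists_eq_conjTranspose_mul_self
    (h 2 _ (Matrix.posSemidef_vecMulVec_self_star w))
  have hsingle : ∀ i j, (Matrix.of fun k l => Matrix.vecMulVec w (star w) (i, k) (j, l))
      = Matrix.single i j (1 : ℂ) := by
    intro i j
    ext k l
    simp only [hw, Matrix.of_apply, Matrix.vecMulVec_apply, Pi.star_apply, Matrix.single_apply]
    by_cases h1 : i = k <;> by_cases h2 : j = l <;> simp [h1, h2]
  have hC : ∀ i j p q, Φ (Matrix.single i j 1) p q = ∑ r, star (B r (i, p)) * B r (j, q) := by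
    intro i j p q
    rw [← hsingle, ← tensorMap_id_apply, hB]
    rfl
  refine ⟨fun r => Matrix.of fun p i => star (B r (i, p)), LinearMap.ext fun X => ?_⟩
  ext p q
  have hX : Φ X = ∑ i, ∑ j, X i j • Φ (Matrix.single i j 1) := by
    conv_lhs => rw [Matrix.matrix_eq_sum_single X]
    simp only [map_sum, ← map_smul, Matrix.smul_single, smul_eq_mul, mul_one]
  rw [hX, LinearMap.sum_apply]
  simp only [Matrix.sum_apply, Matrix.smul_apply, hC, smul_eq_mul, krausMap_apply,
    Matrix.mul_apply, Matrix.conjTranspose_apply, Matrix.of_apply, star_star, Finset.mul_sum,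
    Finset.sum_mul]
  rw [Finset.sum_comm' (t' := Finset.univ) (s' := fun _ => Finset.univ) (by simp)]
  simp only [Fin.sum_univ_two, Fintype.sum_prod_type]
  ring

theorem trace_krausMap_vecMulVec (M : Matrix (Fin 2) (Fin 2) ℂ) (v : Fin 2 → ℂ) :
    (krausMap M (Matrix.vecMulVec v (star v))).trace = (nsq (M *ᵥ v) : ℝ) := by
  have : krausMap M (Matrix.vecMulVec v (star v)) = Matrix.vecMulVec (M *ᵥ v) (star (M *ᵥ v)) := by
    rw [krausMap_apply, Matrix.mul_vecMulVec, Matrix.vecMulVec_mul, Matrix.star_mulVec]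
  rw [this]
  simp [Matrix.trace, Matrix.diag, Fin.sum_univ_two, Matrix.vecMulVec_apply, nsq,
    Complex.normSq_eq_conj_mul_self, mul_comm]

theorem trace_vecMulVec_star (v : Fin 2 → ℂ) :
    (Matrix.vecMulVec v (star v)).trace = (nsq v : ℝ) := by
  have := trace_krausMap_vecMulVec 1 v
  simpa [krausMap_apply] using this

theorem trace_sum_krausMap {r : Type} [Fintype r] (M : r → Matrix (Fin 2) (Fin 2) ℂ)
    (v : Fin 2 → ℂ) :
    ((∑ x, krausMap (M x)) (Matrix.vecMulVec v (star v))).trace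
      = ((∑ x, nsq (M x *ᵥ v) : ℝ) : ℂ) := by
  rw [LinearMap.sum_apply, Matrix.trace_sum]
  simp only [trace_krausMap_vecMulVec, Complex.ofReal_sum]

theorem isMeasurement_of_hasSum_trace {I r : Type} [Fintype r]
    {M : I → r → Matrix (Fin 2) (Fin 2) ℂ}
    (h : ∀ v, HasSum (fun i => ((∑ x, krausMap (M i x)) (Matrix.vecMulVec v (star v))).trace)
      (nsq v : ℝ)) :
    IsMeasurement fun x : Σ _ : I, r => M x.1 x.2 := by
  intro v
  have h1 := h v
  simp only [trace_sum_krausMap] at h1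
  have h2 : HasSum (fun i => ∑ x, nsq (M i x *ᵥ v)) (nsq v) := Complex.hasSum_ofReal.1 h1
  refine HasSum.sigma_of_hasSum h2 (fun i => hasSum_fintype _) ?_
  rw [summable_sigma_of_nonneg fun _ => nsq_nonneg _]
  exact ⟨fun i => (hasSum_fintype _).summable, by simpa only [tsum_fintype] using h2.summable⟩

theorem isMeasurement_of_trace {r : Type} [Fintype r] {N : r → Matrix (Fin 2) (Fin 2) ℂ}
    (h : ∀ ρ, ((∑ x, krausMap (N x)) ρ).trace = ρ.trace) : IsMeasurement N := by
  intro v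
  have h1 := h (Matrix.vecMulVec v (star v))
  rw [trace_sum_krausMap, trace_vecMulVec_star, Complex.ofReal_inj] at h1
  rw [← h1]
  exact hasSum_fintype _

theorem isDissipative_of_isMeasurement {I r s : Type} {M : I → r → Matrix (Fin 2) (Fin 2) ℂ}
    {N : I → s → Matrix (Fin 2) (Fin 2) ℂ} (hM : IsMeasurement fun x : Σ _ : I, r => M x.1 x.2)
    (hN : ∀ i, IsMeasurement (N i)) :
    IsDissipative (fun x : Σ _ : I, r × s => M x.1 x.2.1) (fun x => N x.1 x.2.2) := by
  have h := hM.isDissipative.sigma (J := fun _ => s) (M' := fun _ _ => 1) (N' := fun i => N i.1)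
    (fun i => (hN i.1).isDissipative.symm)
  let e : (Σ _ : I, r × s) ≃ Σ _ : (Σ _ : I, r), s :=
    { toFun := fun x => ⟨⟨x.1, x.2.1⟩, x.2.2⟩
      invFun := fun x => ⟨x.1.1, (x.1.2, x.2)⟩
      left_inv := fun _ => rfl
      right_inv := fun _ => rfl }
  simp only [one_mul, mul_one] at h
  exact h.comp_equiv e

theorem IsInstrument.hasSum_trace {n Θ : Type} [Fintype n] {F : Family n Θ} (h : IsInstrument F)
    (ρ : Matrix n n ℂ) : HasSum (fun j => (F j ρ).trace) ρ.trace := by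
  rw [← h.trace_tsum ρ]
  exact (h.summable ρ).hasSum.map (Matrix.traceAddMonoidHom n ℂ) (continuous_id.matrix_trace)

theorem trace_P0 : P0.trace = 1 := by simp [P0, Matrix.trace_fin_two]

theorem OneWayLocal.exists_krausMap {I : Type} {F : Family (Fin 2 × Fin 2) I}
    (h : OneWayLocal F) :
    ∃ M N : I → (Fin 2 × Fin 2) × (Fin 2 × Fin 2) → Matrix (Fin 2) (Fin 2) ℂ,
      (∀ i, F i = ∑ x, krausMap (M i x ⊗ₖ N i x)) ∧
      IsDissipative (fun x : Σ _ : I, (Fin 2 × Fin 2) × (Fin 2 × Fin 2) => M x.1 x.2)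
        (fun x => N x.1 x.2) := by
  rcases h with ⟨hF, h⟩ | ⟨hF, h⟩
  · choose E T hE hT hF' using h
    choose M hM using fun i => (hE i).exists_krausMap
    choose N hN using fun i => (hT i).1.exists_krausMap
    refine ⟨fun i x => M i x.1, fun i x => N i x.2,
      fun i => by rw [hF', hM, hN, tensorMap_sum_krausMap],
      isDissipative_of_isMeasurement (isMeasurement_of_hasSum_trace fun v => ?_)
        (fun i => isMeasurement_of_trace fun ρ => by rw [← hN]; exact (hT i).2 ρ)⟩
    have h1 := hF.hasSum_trace (Matrix.vecMulVec v (star v) ⊗ₖ P0)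
    simp only [hF', tensorMap_kronecker, Matrix.trace_kronecker, (hT _).2, trace_P0, mul_one,
      trace_vecMulVec_star] at h1
    simpa only [hM] using h1
  · choose T E hT hE hF' using h
    choose M hM using fun i => (hT i).1.exists_krausMap
    choose N hN using fun i => (hE i).exists_krausMap
    have h0 := isDissipative_of_isMeasurement (M := N) (N := M)
      (isMeasurement_of_hasSum_trace fun v => ?_)
      (fun i => isMeasurement_of_trace fun ρ => by rw [← hM]; exact (hT i).2 ρ)
    · let e : (Σ _ : I, (Fin 2 × Fin 2) × (Fin 2 × Fin 2))
          ≃ (Σ _ : I, (Fin 2 × Fin 2) × (Fin 2 × Fin 2)) :=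
        Equiv.sigmaCongrRight fun _ => Equiv.prodComm _ _
      exact ⟨fun i x => M i x.1, fun i x => N i x.2,
        fun i => by rw [hF', hM, hN, tensorMap_sum_krausMap], h0.symm.comp_equiv e⟩
    have h1 := hF.hasSum_trace (P0 ⊗ₖ Matrix.vecMulVec v (star v))
    simp only [hF', tensorMap_kronecker, Matrix.trace_kronecker, (hT _).2, trace_P0, one_mul,
      trace_vecMulVec_star] at h1
    simpa only [hN] using h1

/-! ### Kraus representations of LOCC instruments -/

/-- The maps of `J` have the Kraus operators `A k ⊗ B k`, where `f k` is the outcome to which the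
`k`-th operator contributes. -/
def IsKrausRep {Θ K : Type} (J : Family (Fin 2 × Fin 2) Θ) (f : K → Θ)
    (A B : K → Matrix (Fin 2) (Fin 2) ℂ) : Prop :=
  ∀ θ ρ, HasSum (fun k : {k // f k = θ} => krausMap (A k ⊗ₖ B k) ρ) (J θ ρ)

theorem norm_sq_le_frobSq (A : Matrix (Fin 2) (Fin 2) ℂ) (i j : Fin 2) :
    ‖A i j‖ ^ 2 ≤ frobSq A := by
  have h := fun i j => Complex.normSq_nonneg (A i j)
  have := h 0 0
  have := h 0 1
  have := h 1 0
  have := h 1 1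
  rw [← Complex.normSq_eq_norm_sq]
  simp only [frobSq, nsq, Matrix.mulVec, dotProduct, Fin.sum_univ_two]
  fin_cases i <;> fin_cases j <;> simp <;> linarith

theorem norm_krausMap_apply_le (A B : Matrix (Fin 2) (Fin 2) ℂ)
    (ρ : Matrix (Fin 2 × Fin 2) (Fin 2 × Fin 2) ℂ) (p q : Fin 2 × Fin 2) :
    ‖krausMap (A ⊗ₖ B) ρ p q‖ ≤ frobSq A * frobSq B * ∑ s, ∑ r, ‖ρ r s‖ := by
  have hentry : ∀ p q, ‖(A ⊗ₖ B) p q‖ ≤ √(frobSq A * frobSq B) := fun p q => by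
    refine Real.le_sqrt_of_sq_le ?_
    rw [Matrix.kroneckerMap_apply, norm_mul, mul_pow]
    exact mul_le_mul (norm_sq_le_frobSq _ _ _) (norm_sq_le_frobSq _ _ _) (sq_nonneg _)
      (frobSq_nonneg _)
  have hsq : √(frobSq A * frobSq B) * √(frobSq A * frobSq B) = frobSq A * frobSq B :=
    Real.mul_self_sqrt (mul_nonneg (frobSq_nonneg _) (frobSq_nonneg _))
  rw [krausMap_apply, Matrix.mul_apply, Finset.mul_sum]
  refine (norm_sum_le _ _).trans (Finset.sum_le_sum fun s _ => ?_)
  rw [Matrix.mul_apply, Finset.sum_mul, Finset.mul_sum]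
  refine (norm_sum_le _ _).trans (Finset.sum_le_sum fun r _ => ?_)
  rw [Matrix.conjTranspose_apply, norm_mul, norm_mul, norm_star, ← hsq]
  calc ‖(A ⊗ₖ B) p r‖ * ‖ρ r s‖ * ‖(A ⊗ₖ B) q s‖
      ≤ √(frobSq A * frobSq B) * ‖ρ r s‖ * √(frobSq A * frobSq B) := by
        gcongr
        · exact hentry _ _
        · exact hentry _ _
    _ = _ := by ring

theorem IsDissipative.summable_krausMap {I : Type} {M N : I → Matrix (Fin 2) (Fin 2) ℂ}
    (h : IsDissipative M N) (ρ : Matrix (Fin 2 × Fin 2) (Fin 2 × Fin 2) ℂ) :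
    Summable fun i => krausMap (M i ⊗ₖ N i) ρ := by
  refine Pi.summable.2 fun p => Pi.summable.2 fun q => ?_
  exact Summable.of_norm_bounded (h.summable.mul_right (∑ s, ∑ r, ‖ρ r s‖))
    fun i => norm_krausMap_apply_le _ _ ρ p q

theorem krausMap_mul {n : Type} [Fintype n] (M N ρ : Matrix n n ℂ) :
    krausMap (M * N) ρ = krausMap M (krausMap N ρ) := by
  simp only [krausMap_apply, Matrix.conjTranspose_mul, Matrix.mul_assoc]

theorem krausMap_one {n : Type} [Fintype n] [DecidableEq n] (ρ : Matrix n n ℂ) :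
    krausMap 1 ρ = ρ := by simp [krausMap_apply]

theorem LinkedTo.exists_isKrausRep {Θ Θ' : Type} {J : Family (Fin 2 × Fin 2) Θ}
    {J' : Family (Fin 2 × Fin 2) Θ'} (h : LinkedTo J' J) {K : Type} {f : K → Θ}
    {A B : K → Matrix (Fin 2) (Fin 2) ℂ} (hAB : IsDissipative A B) (hJ : IsKrausRep J f A B) :
    ∃ (K' : Type) (f' : K' → Θ') (A' B' : K' → Matrix (Fin 2) (Fin 2) ℂ),
      IsDissipative A' B' ∧ IsKrausRep J' f' A' B' ∧ totalValue A' B' ≤ totalValue A B := by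
  obtain ⟨I, F, hF, g, hg⟩ := h
  choose M N hMN hd using fun j => (hF j).exists_krausMap
  let S : Type := (Fin 2 × Fin 2) × (Fin 2 × Fin 2)
  -- The Kraus operators are grouped by the outcomes `(j, i)` of the two steps, which makes the sum
  -- over a cell of the coarse-graining an iterated sum.
  let K' : Type := Σ p : (Σ j, I j), Σ _ : {k // f k = p.1}, S
  let e : K' ≃ Σ k : K, Σ _ : I (f k), S :=
    { toFun := fun x => ⟨x.2.1, ⟨x.2.1.2.symm ▸ x.1.2, x.2.2⟩⟩
      invFun := fun x => ⟨⟨f x.1, x.2.1⟩, ⟨⟨x.1, rfl⟩, x.2.2⟩⟩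
      left_inv := by
        rintro ⟨⟨j, i⟩, ⟨⟨k, h⟩, s⟩⟩
        obtain rfl : f k = j := h
        rfl
      right_inv := fun _ => rfl }
  let A' : K' → Matrix (Fin 2) (Fin 2) ℂ := fun x => M x.1.1 x.1.2 x.2.2 * A x.2.1
  let B' : K' → Matrix (Fin 2) (Fin 2) ℂ := fun x => N x.1.1 x.1.2 x.2.2 * B x.2.1
  have h1 := hAB.sigma (J := fun k => Σ _ : I (f k), S) (M' := fun k x => M (f k) x.1 x.2)
    (N' := fun k x => N (f k) x.1 x.2) (fun k => hd (f k))
  have eA : (fun x => M (f (e x).1) (e x).2.1 (e x).2.2 * A (e x).1) = A' := by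
    funext x
    obtain ⟨⟨j, i⟩, ⟨⟨k, h⟩, s⟩⟩ := x
    obtain rfl : f k = j := h
    rfl
  have eB : (fun x => N (f (e x).1) (e x).2.1 (e x).2.2 * B (e x).1) = B' := by
    funext x
    obtain ⟨⟨j, i⟩, ⟨⟨k, h⟩, s⟩⟩ := x
    obtain rfl : f k = j := h
    rfl
  have hd' : IsDissipative A' B' := by
    rw [← eA, ← eB]
    exact h1.comp_equiv e
  refine ⟨K', fun x => g x.1, A', B', hd', fun θ ρ => ?_, ?_⟩
  · let E := Equiv.subtypeSigmaEquiv (fun p : Σ j, I j => Σ _ : {k // f k = p.1}, S)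
      (fun p => g p = θ)
    have hsum := (hd'.summable_krausMap ρ).subtype (fun x : K' => g x.1 = θ)
    rw [← E.symm.hasSum_iff]
    have hsum' := (E.symm.summable_iff).2 hsum
    refine HasSum.sigma_of_hasSum (hg θ ρ) (fun p => ?_) hsum'
    have h2 : HasSum (fun k : {k // f k = p.1.1} =>
        F p.1.1 p.1.2 (krausMap (A k ⊗ₖ B k) ρ)) (F p.1.1 p.1.2 (J p.1.1 ρ)) :=
      (hJ p.1.1 ρ).map (F p.1.1 p.1.2) (LinearMap.continuous_of_finiteDimensional _)
    refine HasSum.sigma_of_hasSum h2 (fun k => ?_) (hsum'.sigma_factor p)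
    have h3 : F p.1.1 p.1.2 (krausMap (A k ⊗ₖ B k) ρ)
        = ∑ s : S, krausMap ((M p.1.1 p.1.2 s * A k) ⊗ₖ (N p.1.1 p.1.2 s * B k)) ρ := by
      rw [hMN, LinearMap.sum_apply]
      exact Finset.sum_congr rfl fun s _ => by rw [Matrix.mul_kronecker_mul, krausMap_mul]
    rw [h3]
    exact hasSum_fintype _
  · rw [totalValue, ← eA, ← eB,
      e.tsum_eq (fun x => ENNReal.ofReal (value (M (f x.1) x.2.1 x.2.2 * A x.1)
        (N (f x.1) x.2.1 x.2.2 * B x.1)))]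
    exact totalValue_sigma_le (J := fun k => Σ _ : I (f k), S) A B
      (M' := fun k x => M (f k) x.1 x.2) (N' := fun k x => N (f k) x.1 x.2) (fun k => hd (f k))

/-- A coarse-graining of a one-way local instrument is linked to the trivial instrument. -/
theorem OneWayLocal.linkedTo_id {a b : Type} [Fintype a] [Fintype b] {Θ Θ' : Type}
    {F : Family (a × b) Θ} {J : Family (a × b) Θ'} (hF : OneWayLocal F)
    (h : IsCoarseGraining F J) : LinkedTo J (fun _ : Unit => LinearMap.id) := by
  obtain ⟨g, hg⟩ := h
  refine ⟨fun _ => Θ, fun _ => F, fun _ => hF, fun p => g p.2, fun k ρ => ?_⟩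
  let e : {p : (Σ _ : Unit, Θ) // g p.2 = k} ≃ {j // g j = k} :=
    { toFun := fun p => ⟨p.1.2, p.2⟩
      invFun := fun j => ⟨⟨(), j.1⟩, j.2⟩
      left_inv := fun _ => rfl
      right_inv := fun _ => rfl }
  exact e.hasSum_iff.2 (hg k ρ)

theorem LOCCRounds.exists_isKrausRep (r : ℕ) : ∀ {Θ : Type} {J : Family (Fin 2 × Fin 2) Θ},
    J ∈ LOCCRounds (Fin 2) (Fin 2) r Θ →
    ∃ (K : Type) (f : K → Θ) (A B : K → Matrix (Fin 2) (Fin 2) ℂ),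
      IsDissipative A B ∧ IsKrausRep J f A B := by
  induction r with
  | zero => exact fun h => h.elim
  | succ r ih =>
    intro Θ J h
    obtain ⟨Θ', J', hJ', K, f, A, B, hAB, hrep⟩ : ∃ (Θ' : Type) (J' : Family (Fin 2 × Fin 2) Θ'),
        LinkedTo J J' ∧ ∃ (K : Type) (f : K → Θ') (A B : K → Matrix (Fin 2) (Fin 2) ℂ),
          IsDissipative A B ∧ IsKrausRep J' f A B := by
      cases r with
      | zero =>
        obtain ⟨Θ₀, F, hF, hFJ, -⟩ := h
        refine ⟨Unit, _, hF.linkedTo_id hFJ, Unit, id, _, _, isDissipative_one, fun θ ρ => ?_⟩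
        have : Unique {k : Unit // id k = θ} := ⟨⟨⟨(), rfl⟩⟩, fun _ => rfl⟩
        simp only [Matrix.one_kronecker_one, krausMap_one]
        exact hasSum_unique (fun _ => ρ)
      | succ r =>
        obtain ⟨Θ₀, J₀, h₀, hJ, -⟩ := h
        exact ⟨Θ₀, J₀, hJ, ih h₀⟩
    obtain ⟨K', f', A', B', h1, h2, -⟩ := hJ'.exists_isKrausRep hAB hrep
    exact ⟨K', f', A', B', h1, h2⟩

/-! ### Convergence of instruments is convergence of matrix entries -/

theorem sum_eigenvalues_conjTranspose_mul_self {n : Type} [Fintype n] [DecidableEq n]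
    (A : Matrix n n ℂ) :
    ∑ i, (Matrix.isHermitian_conjTranspose_mul_self A).eigenvalues i = ∑ q, ∑ p, ‖A p q‖ ^ 2 := by
  have h := (Matrix.isHermitian_conjTranspose_mul_self A).trace_eq_sum_eigenvalues
  have h2 : (Aᴴ * A).trace = ((∑ q, ∑ p, ‖A p q‖ ^ 2 : ℝ) : ℂ) := by
    simp only [Matrix.trace, Matrix.diag, Matrix.mul_apply, Matrix.conjTranspose_apply,
      Complex.ofReal_sum, Complex.ofReal_pow]
    exact Finset.sum_congr rfl fun q _ => Finset.sum_congr rfl fun p _ => Complex.conj_mul' _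
  rw [h2] at h
  have h3 : (((∑ i, (Matrix.isHermitian_conjTranspose_mul_self A).eigenvalues i : ℝ)) : ℂ)
      = ((∑ q, ∑ p, ‖A p q‖ ^ 2 : ℝ) : ℂ) := by
    rw [h]
    simp
  exact_mod_cast h3

theorem traceNorm_nonneg {n : Type} [Fintype n] [DecidableEq n] (A : Matrix n n ℂ) :
    0 ≤ traceNorm A :=
  Finset.sum_nonneg fun _ _ => Real.sqrt_nonneg _

theorem norm_apply_le_traceNorm {n : Type} [Fintype n] [DecidableEq n] (A : Matrix n n ℂ)
    (p q : n) : ‖A p q‖ ≤ traceNorm A := by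
  refine (pow_le_pow_iff_left₀ (norm_nonneg _) (traceNorm_nonneg A) two_ne_zero).1 ?_
  calc ‖A p q‖ ^ 2 ≤ ∑ p, ‖A p q‖ ^ 2 :=
        Finset.single_le_sum (f := fun p => ‖A p q‖ ^ 2) (fun _ _ => sq_nonneg _)
          (Finset.mem_univ p)
    _ ≤ ∑ q, ∑ p, ‖A p q‖ ^ 2 :=
        Finset.single_le_sum (f := fun q => ∑ p, ‖A p q‖ ^ 2)
          (fun _ _ => Finset.sum_nonneg fun _ _ => sq_nonneg _) (Finset.mem_univ q)
    _ = ∑ i, √((Matrix.isHermitian_conjTranspose_mul_self A).eigenvalues i) ^ 2 := by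
        rw [← sum_eigenvalues_conjTranspose_mul_self]
        exact Finset.sum_congr rfl fun i _ =>
          (Real.sq_sqrt (Matrix.eigenvalues_conjTranspose_mul_self_nonneg A i)).symm
    _ ≤ traceNorm A ^ 2 := Finset.sum_sq_le_sq_sum_of_nonneg fun _ _ => Real.sqrt_nonneg _

theorem traceNorm_le {n : Type} [Fintype n] [DecidableEq n] (A : Matrix n n ℂ) :
    traceNorm A ≤ Fintype.card n * ∑ q, ∑ p, ‖A p q‖ := by
  have h : ∀ i, √((Matrix.isHermitian_conjTranspose_mul_self A).eigenvalues i)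
      ≤ ∑ q, ∑ p, ‖A p q‖ := fun i => by
    refine Real.sqrt_le_iff.2 ⟨Finset.sum_nonneg fun _ _ => Finset.sum_nonneg fun _ _ =>
      norm_nonneg _, ?_⟩
    calc (Matrix.isHermitian_conjTranspose_mul_self A).eigenvalues i
        ≤ ∑ i, (Matrix.isHermitian_conjTranspose_mul_self A).eigenvalues i :=
          Finset.single_le_sum (f := (Matrix.isHermitian_conjTranspose_mul_self A).eigenvalues)
            (fun i _ => Matrix.eigenvalues_conjTranspose_mul_self_nonneg A i) (Finset.mem_univ i)
      _ = ∑ q, ∑ p, ‖A p q‖ ^ 2 := sum_eigenvalues_conjTranspose_mul_self A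
      _ ≤ ∑ q, (∑ p, ‖A p q‖) ^ 2 :=
          Finset.sum_le_sum fun q _ => Finset.sum_sq_le_sq_sum_of_nonneg fun _ _ => norm_nonneg _
      _ ≤ (∑ q, ∑ p, ‖A p q‖) ^ 2 :=
          Finset.sum_sq_le_sq_sum_of_nonneg fun _ _ => Finset.sum_nonneg fun _ _ => norm_nonneg _
  calc traceNorm A ≤ ∑ _i : n, ∑ q, ∑ p, ‖A p q‖ := Finset.sum_le_sum fun i _ => h i
    _ = _ := by simp

theorem superOp_apply_eq_sum {n : Type} [Fintype n] [DecidableEq n] (Φ : SuperOp n)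
    (X : Matrix n n ℂ) (p q : n) : Φ X p q = ∑ k, ∑ l, X k l * Φ (Matrix.single k l 1) p q := by
  have hX : Φ X = ∑ i, ∑ j, X i j • Φ (Matrix.single i j 1) := by
    conv_lhs => rw [Matrix.matrix_eq_sum_single X]
    simp only [map_sum, ← map_smul, Matrix.smul_single, smul_eq_mul, mul_one]
  rw [hX]
  simp only [Matrix.sum_apply, Matrix.smul_apply, smul_eq_mul]

theorem ConvergesTo.tendsto_apply {n Θ : Type} [Fintype n] [DecidableEq n]
    {s : ℕ → Family n Θ} {J : Family n Θ} (h : ConvergesTo s J) (j : Θ) (ρ : Matrix n n ℂ)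
    (p q : n) : Tendsto (fun ν => s ν j ρ p q) atTop (𝓝 (J j ρ p q)) := by
  set X : Matrix (n × n) (n × n) ℂ := Matrix.single p p 1 ⊗ₖ ρ with hX
  set C : ℝ := Fintype.card (n × n) * ∑ y, ∑ x, ‖X x y‖ with hC
  have hC0 : 0 ≤ C := by positivity
  set c : ℝ := (C + 1)⁻¹ with hc
  have hc0 : 0 < c := by positivity
  have hX1 : traceNorm ((c : ℂ) • X) ≤ 1 := by
    refine (traceNorm_le _).trans ?_
    simp only [Matrix.smul_apply, smul_eq_mul, norm_mul, ← Finset.mul_sum]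
    rw [Complex.norm_of_nonneg hc0.le, mul_left_comm, ← hC, hc, inv_mul_le_one₀ (by positivity)]
    linarith
  have hle : ∀ ν, ENNReal.ofReal (c * ‖s ν j ρ p q - J j ρ p q‖) ≤ instDist (s ν) J := by
    intro ν
    have h1 : c * ‖s ν j ρ p q - J j ρ p q‖
        ≤ traceNorm (tensorMap LinearMap.id (s ν j - J j) ((c : ℂ) • X)) := by
      refine le_trans (le_of_eq ?_) (norm_apply_le_traceNorm _ (p, p) (p, q))
      rw [map_smul, hX, tensorMap_kronecker, Matrix.smul_apply, Matrix.kroneckerMap_apply]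
      simp [abs_of_pos hc0]
    refine (ENNReal.ofReal_le_ofReal h1).trans ?_
    refine le_trans ?_ (le_iSup₂_of_le ((c : ℂ) • X) hX1 le_rfl)
    exact ENNReal.le_tsum (f := fun j => ENNReal.ofReal
      (traceNorm (tensorMap LinearMap.id (s ν j - J j) ((c : ℂ) • X)))) j
  have h0 : Tendsto (fun ν => ENNReal.ofReal (c * ‖s ν j ρ p q - J j ρ p q‖)) atTop (𝓝 0) :=
    tendsto_of_tendsto_of_tendsto_of_le_of_le tendsto_const_nhds h (fun _ => zero_le) hle
  have h1 := (ENNReal.tendsto_toReal ENNReal.zero_ne_top).comp h0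
  have h2 : Tendsto (fun ν => c * ‖s ν j ρ p q - J j ρ p q‖) atTop (𝓝 0) := by
    refine h1.congr fun ν => ?_
    exact ENNReal.toReal_ofReal (by positivity)
  have h3 := h2.const_mul c⁻¹
  simp only [inv_mul_cancel_left₀ hc0.ne', mul_zero] at h3
  exact tendsto_iff_norm_sub_tendsto_zero.2 h3

theorem convergesTo_of_tendsto_apply {n Θ : Type} [Fintype n] [DecidableEq n] [Fintype Θ]
    {s : ℕ → Family n Θ} {J : Family n Θ}
    (h : ∀ j k l p q, Tendsto (fun ν => s ν j (Matrix.single k l 1) p q) atTop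
      (𝓝 (J j (Matrix.single k l 1) p q))) : ConvergesTo s J := by
  set D : ℕ → Θ → (n × n) → (n × n) → ℝ := fun ν j y x =>
    ∑ k, ∑ l, ‖s ν j (Matrix.single k l 1) x.2 y.2 - J j (Matrix.single k l 1) x.2 y.2‖ with hD
  have hle : ∀ ν, instDist (s ν) J
      ≤ ENNReal.ofReal (∑ j, Fintype.card (n × n) * ∑ y, ∑ x, D ν j y x) := by
    intro ν
    refine iSup₂_le fun X hX => ?_
    rw [tsum_fintype, ENNReal.ofReal_sum_of_nonneg fun j _ => by positivity]
    refine Finset.sum_le_sum fun j _ => ENNReal.ofReal_le_ofReal ((traceNorm_le _).trans ?_)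
    gcongr with y _ x _
    obtain ⟨i, p⟩ := x
    obtain ⟨i', q⟩ := y
    rw [tensorMap_id_apply, superOp_apply_eq_sum]
    refine (norm_sum_le _ _).trans (Finset.sum_le_sum fun k _ => (norm_sum_le _ _).trans
      (Finset.sum_le_sum fun l _ => ?_))
    rw [norm_mul]
    exact mul_le_of_le_one_left (norm_nonneg _) ((norm_apply_le_traceNorm X _ _).trans hX)
  have hlim : Tendsto (fun ν => ∑ j, Fintype.card (n × n) * ∑ y, ∑ x, D ν j y x) atTop (𝓝 0) := by
    have h0 : (0 : ℝ) = ∑ _j : Θ, Fintype.card (n × n) * ∑ _y : n × n, ∑ _x : n × n,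
        ∑ _k : n, ∑ _l : n, (0 : ℝ) := by simp
    rw [h0]
    refine tendsto_finsetSum _ fun j _ => Tendsto.const_mul _ (tendsto_finsetSum _ fun y _ =>
      tendsto_finsetSum _ fun x _ => tendsto_finsetSum _ fun k _ => tendsto_finsetSum _ fun l _ =>
        tendsto_iff_norm_sub_tendsto_zero.1 (h j k l x.2 y.2))
  have h1 := ENNReal.tendsto_ofReal hlim
  rw [ENNReal.ofReal_zero] at h1
  exact tendsto_of_tendsto_of_tendsto_of_le_of_le tendsto_const_nhds h1 (fun _ => zero_le) hle

/-- The matrix entries of the maps of an instrument. -/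
def entries {n Θ : Type} [DecidableEq n] (J : Family n Θ) : Θ → n → n → n → n → ℂ :=
  fun j k l p q => J j (Matrix.single k l 1) p q

theorem convergesTo_iff {n Θ : Type} [Fintype n] [DecidableEq n] [Fintype Θ]
    {s : ℕ → Family n Θ} {J : Family n Θ} :
    ConvergesTo s J ↔ Tendsto (fun ν => entries (s ν)) atTop (𝓝 (entries J)) := by
  simp only [tendsto_pi_nhds]
  exact ⟨fun h j k l p q => h.tendsto_apply j _ p q, fun h => convergesTo_of_tendsto_apply h⟩

theorem mem_instClosure_iff {n Θ : Type} [Fintype n] [DecidableEq n] [Fintype Θ]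
    {S : Set (Family n Θ)} {J : Family n Θ} :
    J ∈ instClosure S ↔ IsInstrument J ∧ entries J ∈ closure (entries '' S) := by
  refine and_congr_right fun _ => ?_
  rw [mem_closure_iff_seq_limit]
  constructor
  · rintro ⟨s, hs, h⟩
    exact ⟨fun ν => entries (s ν), fun ν => ⟨_, hs ν, rfl⟩, convergesTo_iff.1 h⟩
  · rintro ⟨x, hx, h⟩
    choose s hs hsx using hx
    refine ⟨s, hs, convergesTo_iff.2 ?_⟩
    simpa only [hsx] using h

/-! ### The coherence functional -/

theorem krausMap_single_apply {n : Type} [Fintype n] [DecidableEq n] (M : Matrix n n ℂ)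
    (k l p q : n) : krausMap M (Matrix.single k l 1) p q = M p k * star (M q l) := by
  rw [krausMap_apply, Matrix.mul_apply, Finset.sum_eq_single l]
  · rw [Matrix.mul_single_apply_same, mul_one, Matrix.conjTranspose_apply]
  · intro x _ hx
    rw [Matrix.mul_single_apply_of_ne _ _ _ _ _ hx, zero_mul]
  · simp

/-- The coherence between `|0⟩` and `|1⟩` that a map retains on Alice's side when Bob holds `|0⟩`,
corrected by terms that penalize transitions between the two basis states. With this correction
it is at most `‖det A‖ ‖B e₀‖²` for `ρ ↦ (A ⊗ B) ρ (A ⊗ B)†`. -/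
def coherenceA (Φ : SuperOp (Fin 2 × Fin 2)) : ℝ :=
  (∑ q, Φ (Matrix.single (0, 0) (1, 0) 1) (0, q) (1, q)).re
    - ((∑ q, Φ (Matrix.single (1, 0) (1, 0) 1) (0, q) (0, q)).re
      + (∑ q, Φ (Matrix.single (0, 0) (0, 0) 1) (1, q) (1, q)).re) / 2

/-- The counterpart of `coherenceA` with the parties exchanged. -/
def coherenceB (Φ : SuperOp (Fin 2 × Fin 2)) : ℝ :=
  (∑ p, Φ (Matrix.single (0, 0) (0, 1) 1) (p, 0) (p, 1)).re
    - ((∑ p, Φ (Matrix.single (0, 1) (0, 1) 1) (p, 0) (p, 0)).re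
      + (∑ p, Φ (Matrix.single (0, 0) (0, 0) 1) (p, 1) (p, 1)).re) / 2

theorem re_mul_star_sub_le_norm_det (A : Matrix (Fin 2) (Fin 2) ℂ) :
    (A 0 0 * star (A 1 1)).re - (Complex.normSq (A 0 1) + Complex.normSq (A 1 0)) / 2
      ≤ ‖A.det‖ := by
  have h1 : (A 0 0 * star (A 1 1)).re ≤ ‖A 0 0 * A 1 1‖ := by
    refine (Complex.re_le_norm _).trans_eq ?_
    rw [norm_mul, norm_mul, norm_star]
  have h2 : ‖A 0 0 * A 1 1‖ ≤ ‖A.det‖ + ‖A 0 1 * A 1 0‖ := by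
    refine le_trans (le_of_eq ?_) (norm_add_le _ _)
    rw [Matrix.det_fin_two, sub_add_cancel]
  rw [norm_mul (A 0 1)] at h2
  rw [Complex.normSq_eq_norm_sq, Complex.normSq_eq_norm_sq]
  nlinarith [sq_nonneg (‖A 0 1‖ - ‖A 1 0‖)]

theorem coherenceA_krausMap (A B : Matrix (Fin 2) (Fin 2) ℂ) :
    coherenceA (krausMap (A ⊗ₖ B)) = ((A 0 0 * star (A 1 1)).re
      - (Complex.normSq (A 0 1) + Complex.normSq (A 1 0)) / 2) * nsq (B *ᵥ ![1, 0]) := by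
  simp only [coherenceA, krausMap_single_apply, Matrix.kroneckerMap_apply, Fin.sum_univ_two]
  simp [nsq, Matrix.mulVec, dotProduct, Fin.sum_univ_two, Complex.normSq_apply]
  ring

theorem coherenceB_krausMap (A B : Matrix (Fin 2) (Fin 2) ℂ) :
    coherenceB (krausMap (A ⊗ₖ B)) = coherenceA (krausMap (B ⊗ₖ A)) := by
  simp only [coherenceA, coherenceB, krausMap_single_apply, Matrix.kroneckerMap_apply,
    mul_comm (B _ _)]

theorem coherenceA_krausMap_le (A B : Matrix (Fin 2) (Fin 2) ℂ) :
    coherenceA (krausMap (A ⊗ₖ B)) ≤ leadNorm A * tailNorm A * leadNorm B ^ 2 := by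
  rw [coherenceA_krausMap, leadNorm_mul_tailNorm, leadNorm_sq]
  exact mul_le_mul_of_nonneg_right (re_mul_star_sub_le_norm_det A) (nsq_nonneg _)

theorem coherenceA_krausMap_le_value (A B : Matrix (Fin 2) (Fin 2) ℂ) :
    coherenceA (krausMap (A ⊗ₖ B)) ≤ value A B := by
  refine (coherenceA_krausMap_le A B).trans ?_
  have hA := leadNorm_nonneg A
  have hB := leadNorm_nonneg B
  have h := le_gain (mul_nonneg (tailNorm_nonneg A) hB) (mul_nonneg hA (tailNorm_nonneg B))
  calc leadNorm A * tailNorm A * leadNorm B ^ 2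
      = leadNorm A * leadNorm B * (tailNorm A * leadNorm B) := by ring
    _ ≤ value A B := mul_le_mul_of_nonneg_left h (mul_nonneg hA hB)

/-- At a conformal pair, the part `1 / 4` of the value can only be extracted by further
measurements. -/
theorem IsConformalPair.coherenceA_le {A B : Matrix (Fin 2) (Fin 2) ℂ}
    (h : IsConformalPair A B) : coherenceA (krausMap (A ⊗ₖ B)) ≤ 3 / 4 * value A B := by
  refine (coherenceA_krausMap_le A B).trans ?_
  rcases h.cases with h0 | ⟨c, d, hc, hd, hA, hB⟩
  · have h1 := h0 ![1, 0] ![1, 0]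
    rw [← leadNorm_sq, ← leadNorm_sq] at h1
    have h2 : leadNorm A * leadNorm B = 0 := by
      rw [← mul_pow] at h1
      exact pow_eq_zero_iff two_ne_zero |>.1 h1
    have h3 : leadNorm A * tailNorm A * leadNorm B ^ 2 = 0 := by
      linear_combination tailNorm A * leadNorm B * h2
    rw [h3]
    exact mul_nonneg (by norm_num) (value_nonneg _ _)
  · rw [hA.value hB, hA.leadNorm, hA.tailNorm, hB.leadNorm, Real.mul_self_sqrt hc.le,
      Real.sq_sqrt hd.le]
    linarith

theorem hasSum_re_apply {ι n : Type} {F : ι → Matrix n n ℂ} {X : Matrix n n ℂ}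
    (h : HasSum F X) (p q : n) : HasSum (fun i => (F i p q).re) (X p q).re :=
  Complex.hasSum_re (Pi.hasSum.1 (Pi.hasSum.1 h p) q)

theorem hasSum_coherenceA {ι : Type} {F : ι → SuperOp (Fin 2 × Fin 2)}
    {Φ : SuperOp (Fin 2 × Fin 2)} (h : ∀ ρ, HasSum (fun i => F i ρ) (Φ ρ)) :
    HasSum (fun i => coherenceA (F i)) (coherenceA Φ) := by
  simp only [coherenceA, Fin.sum_univ_two, Complex.add_re]
  have e := fun ρ p q => hasSum_re_apply (h ρ) p q
  exact ((e _ _ _).add (e _ _ _)).sub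
    ((((e _ _ _).add (e _ _ _)).add ((e _ _ _).add (e _ _ _))).div_const 2)

theorem hasSum_coherenceB {ι : Type} {F : ι → SuperOp (Fin 2 × Fin 2)}
    {Φ : SuperOp (Fin 2 × Fin 2)} (h : ∀ ρ, HasSum (fun i => F i ρ) (Φ ρ)) :
    HasSum (fun i => coherenceB (F i)) (coherenceB Φ) := by
  simp only [coherenceB, Fin.sum_univ_two, Complex.add_re]
  have e := fun ρ p q => hasSum_re_apply (h ρ) p q
  exact ((e _ _ _).add (e _ _ _)).sub
    ((((e _ _ _).add (e _ _ _)).add ((e _ _ _).add (e _ _ _))).div_const 2)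

/-- The total coherence of an instrument with three outcomes: Alice's coherence at the
outcome `01` and Bob's at the outcome `10`. -/
def coherence (J : Family (Fin 2 × Fin 2) (Fin 3)) : ℝ := coherenceA (J 1) + coherenceB (J 2)

theorem ConvergesTo.tendsto_coherence {s : ℕ → Family (Fin 2 × Fin 2) (Fin 3)}
    {J : Family (Fin 2 × Fin 2) (Fin 3)} (h : ConvergesTo s J) :
    Tendsto (fun ν => coherence (s ν)) atTop (𝓝 (coherence J)) := by
  simp only [coherence, coherenceA, coherenceB, Fin.sum_univ_two, Complex.add_re]
  have e : ∀ j ρ p q, Tendsto (fun ν => (s ν j ρ p q).re) atTop (𝓝 (J j ρ p q).re) :=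
    fun j ρ p q => (Complex.continuous_re.tendsto _).comp (h.tendsto_apply j ρ p q)
  exact ((((e _ _ _ _).add (e _ _ _ _)).sub
    ((((e _ _ _ _).add (e _ _ _ _)).add ((e _ _ _ _).add (e _ _ _ _))).div_const 2))).add
    (((e _ _ _ _).add (e _ _ _ _)).sub
    ((((e _ _ _ _).add (e _ _ _ _)).add ((e _ _ _ _).add (e _ _ _ _))).div_const 2))

theorem IsKrausRep.coherence_le {K : Type} {J : Family (Fin 2 × Fin 2) (Fin 3)} {f : K → Fin 3}
    {A B : K → Matrix (Fin 2) (Fin 2) ℂ} (hJ : IsKrausRep J f A B) {c : ℝ} (hc : 0 ≤ c)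
    (hA : ∀ k, coherenceA (krausMap (A k ⊗ₖ B k)) ≤ c * value (A k) (B k))
    (hB : ∀ k, coherenceB (krausMap (A k ⊗ₖ B k)) ≤ c * value (A k) (B k))
    (hV : totalValue A B ≠ ⊤) :
    coherence J ≤ c * (totalValue A B).toReal := by
  have hv : ∀ k, (ENNReal.ofReal (value (A k) (B k))).toReal = value (A k) (B k) := fun k =>
    ENNReal.toReal_ofReal (value_nonneg _ _)
  have hs : Summable fun k => value (A k) (B k) := by
    simpa only [hv] using ENNReal.summable_toReal hV
  have htot : (totalValue A B).toReal = ∑' k, value (A k) (B k) := by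
    rw [totalValue, ENNReal.tsum_toReal_eq fun _ => ENNReal.ofReal_ne_top]
    simp only [hv]
  have hfib : ∀ θ, Summable fun k : {k // f k = θ} => value (A k) (B k) := fun θ =>
    hs.subtype (fun k => f k = θ)
  have hdecomp : ∑' k, value (A k) (B k)
      = ∑ θ, ∑' k : {k // f k = θ}, value (A k) (B k) := by
    rw [← (Equiv.sigmaFiberEquiv f).tsum_eq, Summable.tsum_sigma, tsum_fintype]
    · rfl
    · exact ((Equiv.sigmaFiberEquiv f).summable_iff).2 hs
  have h0 : 0 ≤ ∑' k : {k // f k = 0}, value (A k) (B k) := tsum_nonneg fun _ => value_nonneg _ _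
  have h1 : coherenceA (J 1) ≤ c * ∑' k : {k // f k = 1}, value (A k) (B k) := by
    exact hasSum_le (fun k : {k // f k = 1} => hA k) (hasSum_coherenceA (hJ 1)) ((hfib 1).hasSum.mul_left c)
  have h2 : coherenceB (J 2) ≤ c * ∑' k : {k // f k = 2}, value (A k) (B k) := by
    exact hasSum_le (fun k : {k // f k = 2} => hB k) (hasSum_coherenceB (hJ 2)) ((hfib 2).hasSum.mul_left c)
  rw [htot, hdecomp, Fin.sum_univ_three, coherence]
  nlinarith [mul_nonneg hc h0]

theorem IsKrausRep.coherence_le_totalValue {K : Type} {J : Family (Fin 2 × Fin 2) (Fin 3)}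
    {f : K → Fin 3} {A B : K → Matrix (Fin 2) (Fin 2) ℂ} (hJ : IsKrausRep J f A B)
    (hV : totalValue A B ≠ ⊤) : coherence J ≤ (totalValue A B).toReal := by
  have := hJ.coherence_le zero_le_one
    (fun k => by rw [one_mul]; exact coherenceA_krausMap_le_value _ _)
    (fun k => by
      rw [one_mul, coherenceB_krausMap, value_comm]
      exact coherenceA_krausMap_le_value _ _) hV
  rwa [one_mul] at this

theorem IsKrausRep.coherence_le_of_conformalPair {K : Type}
    {J : Family (Fin 2 × Fin 2) (Fin 3)} {f : K → Fin 3} {A B : K → Matrix (Fin 2) (Fin 2) ℂ}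
    (hJ : IsKrausRep J f A B) (hV : totalValue A B ≠ ⊤)
    (h : ∀ k, IsConformalPair (A k) (B k)) : coherence J ≤ 3 / 4 * (totalValue A B).toReal :=
  hJ.coherence_le (by norm_num) (fun k => (h k).coherenceA_le)
    (fun k => by
      rw [coherenceB_krausMap, value_comm]
      exact (h k).symm.coherenceA_le) hV

theorem IsKrausRep.coarseGraining {Θ Θ' K : Type} {J : Family (Fin 2 × Fin 2) Θ}
    {J' : Family (Fin 2 × Fin 2) Θ'} {f : K → Θ} {A B : K → Matrix (Fin 2) (Fin 2) ℂ}
    (hJ : IsKrausRep J f A B) (hd : IsDissipative A B) (h : IsCoarseGraining J J') :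
    ∃ f' : K → Θ', IsKrausRep J' f' A B := by
  obtain ⟨g, hg⟩ := h
  refine ⟨fun k => g (f k), fun θ ρ => ?_⟩
  let e := Equiv.sigmaSubtypeFiberEquivSubtype f (p := fun k => g (f k) = θ)
    (q := fun j => g j = θ) (fun _ => Iff.rfl)
  rw [← e.hasSum_iff]
  refine HasSum.sigma_of_hasSum (hg θ ρ) (fun j => ?_) (e.summable_iff.2 ?_)
  · exact hJ j ρ
  · exact (hd.summable_krausMap ρ).subtype (fun k => g (f k) = θ)

/-! ### The target instrument is not in LOCC -/

theorem one_div_sqrt_three_mul_self : (1 / √3 : ℝ) * (1 / √3) = 1 / 3 := by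
  rw [div_mul_div_comm, Real.mul_self_sqrt (by norm_num), one_mul]

theorem one_div_sqrt_six_mul_self : (1 / √6 : ℝ) * (1 / √6) = 1 / 6 := by
  rw [div_mul_div_comm, Real.mul_self_sqrt (by norm_num), one_mul]

theorem one_div_sqrt_six_mul_sqrt : (1 / √6 : ℝ) * √(2 / 3) = 1 / 3 := by
  rw [one_div, ← Real.sqrt_inv, ← Real.sqrt_mul (by norm_num),
    show (6⁻¹ * (2 / 3) : ℝ) = (1 / 3) ^ 2 by norm_num, Real.sqrt_sq (by norm_num)]

theorem coherence_targetInstrument : coherence targetInstrument = 4 / 3 := by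
  have e1 : coherence targetInstrument = coherenceA E01 + coherenceB E10 := rfl
  have hadd : ∀ Φ Ψ, coherenceA (Φ + Ψ) = coherenceA Φ + coherenceA Ψ := fun Φ Ψ => by
    simp only [coherenceA, LinearMap.add_apply, Matrix.add_apply, Finset.sum_add_distrib,
      Complex.add_re]
    ring
  have hadd' : ∀ Φ Ψ, coherenceB (Φ + Ψ) = coherenceB Φ + coherenceB Ψ := fun Φ Ψ => by
    simp only [coherenceB, LinearMap.add_apply, Matrix.add_apply, Finset.sum_add_distrib,
      Complex.add_re]
    ring
  have hdiag : ∀ x y : ℝ, coherenceA (krausMap (!![(x : ℂ), 0; 0, (y : ℂ)] ⊗ₖ P0)) = x * y := by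
    intro x y
    rw [coherenceA_krausMap]
    simp [P0, nsq, Matrix.mulVec, dotProduct, Fin.sum_univ_two]
  have hT1 : coherenceA (krausMap (T1 ⊗ₖ P0)) = 1 / 3 := (hdiag _ _).trans one_div_sqrt_three_mul_self
  have hT2 : coherenceA (krausMap (T2 ⊗ₖ P0)) = 1 / 3 := (hdiag _ _).trans one_div_sqrt_six_mul_sqrt
  rw [e1, E01, E10, hadd, hadd', coherenceB_krausMap, coherenceB_krausMap, hT1, hT2]
  norm_num

theorem targetInstrument_notMem_LOCCInst :
    targetInstrument ∉ LOCCInst (Fin 2) (Fin 2) (Fin 3) := by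
  rintro ⟨-, I, s, hfin, hlink, s', hs', hconv⟩
  have hlim := hconv.tendsto_coherence
  rw [coherence_targetInstrument] at hlim
  by_cases hcase : ∃ (ν : ℕ) (K : Type) (f : K → I ν) (A B : K → Matrix (Fin 2) (Fin 2) ℂ),
      IsDissipative A B ∧ IsKrausRep (s ν) f A B ∧ totalValue A B < ENNReal.ofReal (4 / 3)
  · -- The value lost in round `ν` is never recovered.
    obtain ⟨ν, K, f, A, B, hd, hrep, hlt⟩ := hcase
    set T := totalValue A B with hT
    have hT_top : T ≠ ⊤ := hlt.ne_top
    have hlater : ∀ μ, ν ≤ μ → ∃ (K : Type) (f : K → I μ) (A B : K → Matrix (Fin 2) (Fin 2) ℂ),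
        IsDissipative A B ∧ IsKrausRep (s μ) f A B ∧ totalValue A B ≤ T := by
      intro μ hμ
      induction μ, hμ using Nat.le_induction with
      | base => exact ⟨K, f, A, B, hd, hrep, le_rfl⟩
      | succ μ _ ih =>
        obtain ⟨K, f, A, B, hd, hrep, hle⟩ := ih
        obtain ⟨K', f', A', B', hd', hrep', hle'⟩ := (hlink μ).exists_isKrausRep hd hrep
        exact ⟨K', f', A', B', hd', hrep', hle'.trans hle⟩
    have hbound : ∀ᶠ μ in atTop, coherence (s' μ) ≤ T.toReal := by
      filter_upwards [eventually_ge_atTop ν] with μ hμ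
      obtain ⟨K, f, A, B, hd, hrep, hle⟩ := hlater μ hμ
      obtain ⟨f', hrep'⟩ := hrep.coarseGraining hd (hs' μ).2
      exact (hrep'.coherence_le_totalValue (ne_top_of_le_ne_top hT_top hle)).trans
        (ENNReal.toReal_mono hT_top hle)
    have h1 := le_of_tendsto hlim hbound
    exact h1.not_gt ((ENNReal.lt_ofReal_iff_toReal_lt hT_top).1 hlt)
  · -- Without loss, all Kraus operators are multiples of local unitaries.
    have hbound : ∀ ν, coherence (s' ν) ≤ 1 := by
      intro ν
      obtain ⟨r, -, hr⟩ := hfin ν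
      obtain ⟨K, f, A, B, hd, hrep⟩ := LOCCRounds.exists_isKrausRep r hr
      have hconf := hd.conformalPair_or_totalValue_lt.resolve_right
        fun hlt => hcase ⟨ν, K, f, A, B, hd, hrep, hlt⟩
      obtain ⟨f', hrep'⟩ := hrep.coarseGraining hd (hs' ν).2
      have hle := hd.totalValue_le
      have h1 := hrep'.coherence_le_of_conformalPair
        (ne_top_of_le_ne_top ENNReal.ofReal_ne_top hle) hconf
      have h2 := ENNReal.toReal_le_of_le_ofReal (by norm_num) hle
      linarith
    have h1 := le_of_tendsto' hlim hbound
    norm_num at h1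

/-! ### Completely positive and separable maps -/

theorem tensorMap_id_krausMap {k n : Type} [Fintype k] [Fintype n] [DecidableEq k]
    [DecidableEq n] (M : Matrix n n ℂ) :
    tensorMap (LinearMap.id : SuperOp k) (krausMap M)
      = krausMap ((1 : Matrix k k ℂ) ⊗ₖ M) := by
  refine superOp_ext_kronecker fun A B => ?_
  rw [tensorMap_kronecker, krausMap_kronecker, krausMap_one, LinearMap.id_apply]

theorem posSemidef_tensorMap_krausMap {k n : Type} [Fintype k] [Fintype n] [DecidableEq n]
    (M : Matrix n n ℂ) {X : Matrix (k × n) (k × n) ℂ} (hX : X.PosSemidef) :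
    (tensorMap LinearMap.id (krausMap M) X).PosSemidef := by
  classical
  rw [tensorMap_id_krausMap, krausMap_apply]
  exact hX.mul_mul_conjTranspose_same _

theorem isCP_krausMap {n : Type} [Fintype n] [DecidableEq n] (M : Matrix n n ℂ) :
    IsCP (krausMap M) := fun _ _ hX => posSemidef_tensorMap_krausMap M hX

theorem isCP_id {n : Type} [Fintype n] : IsCP (LinearMap.id : SuperOp n) := fun _ _ hX => hX

theorem isTCP_id {n : Type} [Fintype n] : IsTCP (LinearMap.id : SuperOp n) :=
  ⟨isCP_id, fun _ => rfl⟩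

theorem isCP_zero {n : Type} [Fintype n] : IsCP (0 : SuperOp n) :=
  fun _ _ _ => Matrix.PosSemidef.zero

theorem IsCP.add {n : Type} [Fintype n] {Φ Ψ : SuperOp n} (hΦ : IsCP Φ) (hΨ : IsCP Ψ) :
    IsCP (Φ + Ψ) := fun k X hX => (hΦ k X hX).add (hΨ k X hX)

theorem isInstrument_of_fintype {n Θ : Type} [Fintype n] [Fintype Θ] {J : Family n Θ}
    (hcp : ∀ j, IsCP (J j)) (htr : ∀ ρ, ∑ j, (J j ρ).trace = ρ.trace) : IsInstrument J where
  countable := inferInstance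
  cp := hcp
  summable ρ := (hasSum_fintype _).summable
  trace_tsum ρ := by rw [tsum_fintype, Matrix.trace_sum, htr]

theorem IsSeparableState.add {a b : Type} [Fintype a] [Fintype b]
    {ρ σ : Matrix (a × b) (a × b) ℂ} (hρ : IsSeparableState ρ) (hσ : IsSeparableState σ) :
    IsSeparableState (ρ + σ) := by
  obtain ⟨m, A, B, hA, hB, rfl⟩ := hρ
  obtain ⟨m', A', B', hA', hB', rfl⟩ := hσ
  refine ⟨m + m', Fin.append A A', Fin.append B B', fun i => ?_, fun i => ?_, ?_⟩
  · refine Fin.addCases (fun i => ?_) (fun i => ?_) i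
    · rw [Fin.append_left]
      exact hA i
    · rw [Fin.append_right]
      exact hA' i
  · refine Fin.addCases (fun i => ?_) (fun i => ?_) i
    · rw [Fin.append_left]
      exact hB i
    · rw [Fin.append_right]
      exact hB' i
  · simp only [Fin.sum_univ_add, Fin.append_left, Fin.append_right]

theorem applyWithAncillas_apply {a b a' b' : Type} (E : SuperOp (a × b))
    (ρ : Matrix ((a' × a) × (b' × b)) ((a' × a) × (b' × b)) ℂ)
    (i i' : a') (p p' : a) (j j' : b') (q q' : b) :
    applyWithAncillas E ρ ((i, p), (j, q)) ((i', p'), (j', q'))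
      = E (Matrix.of fun x y => ρ ((i, x.1), (j, x.2)) ((i', y.1), (j', y.2))) (p, q) (p', q') :=
  rfl

theorem IsSeparableMap.add {a b : Type} [Fintype a] [Fintype b] {E F : SuperOp (a × b)}
    (hE : IsSeparableMap E) (hF : IsSeparableMap F) : IsSeparableMap (E + F) := by
  intro a' b' _ _ ρ hρ
  have : applyWithAncillas (E + F) ρ = applyWithAncillas E ρ + applyWithAncillas F ρ := by
    ext ⟨⟨i, p⟩, ⟨j, q⟩⟩ ⟨⟨i', p'⟩, ⟨j', q'⟩⟩
    rfl
  rw [this]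
  exact (hE a' b' ρ hρ).add (hF a' b' ρ hρ)

theorem applyWithAncillas_krausMap_kronecker {a b a' b' : Type} [Fintype a] [Fintype b]
    (M : Matrix a a ℂ) (N : Matrix b b ℂ) (A : Matrix (a' × a) (a' × a) ℂ)
    (B : Matrix (b' × b) (b' × b) ℂ) :
    applyWithAncillas (krausMap (M ⊗ₖ N)) (A ⊗ₖ B)
      = tensorMap LinearMap.id (krausMap M) A ⊗ₖ tensorMap LinearMap.id (krausMap N) B := by
  ext ⟨⟨i, p⟩, ⟨j, q⟩⟩ ⟨⟨i', p'⟩, ⟨j', q'⟩⟩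
  rw [applyWithAncillas_apply, Matrix.kroneckerMap_apply, tensorMap_id_apply, tensorMap_id_apply]
  have : (Matrix.of fun x y : a × b => (A ⊗ₖ B) ((i, x.1), (j, x.2)) ((i', y.1), (j', y.2)))
      = (Matrix.of fun r s => A (i, r) (i', s)) ⊗ₖ (Matrix.of fun r s => B (j, r) (j', s)) := rfl
  rw [this, krausMap_kronecker]
  rfl

theorem isSeparableMap_krausMap {a b : Type} [Fintype a] [Fintype b] [DecidableEq a]
    [DecidableEq b] (M : Matrix a a ℂ) (N : Matrix b b ℂ) :
    IsSeparableMap (krausMap (M ⊗ₖ N)) := by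
  rintro a' b' _ _ ρ ⟨m, A, B, hA, hB, rfl⟩
  refine ⟨m, _, _, fun i => posSemidef_tensorMap_krausMap M (hA i),
    fun i => posSemidef_tensorMap_krausMap N (hB i), ?_⟩
  simp only [← applyWithAncillas_krausMap_kronecker]
  ext ⟨⟨i, p⟩, ⟨j, q⟩⟩ ⟨⟨i', p'⟩, ⟨j', q'⟩⟩
  simp only [Matrix.sum_apply, applyWithAncillas_apply]
  rw [← Matrix.sum_apply, ← map_sum]
  refine congrFun (congrFun (congrArg _ ?_) _) _
  ext x y
  simp only [Matrix.of_apply, Matrix.sum_apply]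

/-! ### The target instrument is separable -/

theorem trace_krausMap {n : Type} [Fintype n] (M ρ : Matrix n n ℂ) :
    (krausMap M ρ).trace = (Mᴴ * M * ρ).trace := by
  rw [krausMap_apply, Matrix.trace_mul_comm, Matrix.mul_assoc]

theorem T1_T2_effect : T1ᴴ * T1 + T2ᴴ * T2 = !![1 / 2, 0; 0, 1] := by
  have h3 : ((1 / √3 : ℝ) : ℂ) * ((1 / √3 : ℝ) : ℂ) = 1 / 3 := by
    rw [← Complex.ofReal_mul, one_div_sqrt_three_mul_self]
    norm_num
  have h6 : ((1 / √6 : ℝ) : ℂ) * ((1 / √6 : ℝ) : ℂ) = 1 / 6 := by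
    rw [← Complex.ofReal_mul, one_div_sqrt_six_mul_self]
    norm_num
  have h23 : ((√(2 / 3) : ℝ) : ℂ) * ((√(2 / 3) : ℝ) : ℂ) = 2 / 3 := by
    rw [← Complex.ofReal_mul, Real.mul_self_sqrt (by norm_num)]
    norm_num
  have hdiag : ∀ x y : ℝ, !![(x : ℂ), 0; 0, (y : ℂ)]ᴴ * !![(x : ℂ), 0; 0, (y : ℂ)]
      = !![(x : ℂ) * x, 0; 0, (y : ℂ) * y] := by
    intro x y
    ext i j
    fin_cases i <;> fin_cases j <;> simp [Matrix.mul_apply, Fin.sum_univ_two]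
  rw [T1, T2, hdiag, hdiag, h3, h6, h23]
  ext i j
  fin_cases i <;> fin_cases j <;> norm_num

theorem P0_effect : P0ᴴ * P0 = P0 := by
  ext i j
  fin_cases i <;> fin_cases j <;> simp [P0, Matrix.mul_apply, Fin.sum_univ_two]

theorem P1_effect : P1ᴴ * P1 = P1 := by
  ext i j
  fin_cases i <;> fin_cases j <;> simp [P1, Matrix.mul_apply, Fin.sum_univ_two]

theorem isInstrument_targetInstrument : IsInstrument targetInstrument := by
  refine isInstrument_of_fintype (fun j => ?_) (fun ρ => ?_)
  · fin_cases j
    · exact isCP_krausMap _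
    · exact (isCP_krausMap _).add (isCP_krausMap _)
    · exact (isCP_krausMap _).add (isCP_krausMap _)
  · rw [Fin.sum_univ_three]
    change (krausMap (P1 ⊗ₖ P1) ρ).trace + (krausMap (T1 ⊗ₖ P0) ρ + krausMap (T2 ⊗ₖ P0) ρ).trace
      + (krausMap (P0 ⊗ₖ T1) ρ + krausMap (P0 ⊗ₖ T2) ρ).trace = ρ.trace
    simp only [Matrix.trace_add, trace_krausMap, Matrix.conjTranspose_kronecker,
      ← Matrix.mul_kronecker_mul, P0_effect, P1_effect]
    simp only [← Matrix.trace_add, ← Matrix.add_mul, ← Matrix.add_kronecker,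
      ← Matrix.kronecker_add, T1_T2_effect]
    have : P1 ⊗ₖ P1 + !![1 / 2, 0; 0, 1] ⊗ₖ P0 + P0 ⊗ₖ !![1 / 2, 0; 0, 1] = 1 := by
      ext ⟨i, j⟩ ⟨k, l⟩
      fin_cases i <;> fin_cases j <;> fin_cases k <;> fin_cases l <;>
        norm_num [P0, P1, Matrix.one_apply]
    rw [this, one_mul]

theorem targetInstrument_mem_SEP : targetInstrument ∈ SEP (Fin 2) (Fin 2) (Fin 3) := by
  refine ⟨isInstrument_targetInstrument, fun j => ?_⟩
  fin_cases j
  · exact isSeparableMap_krausMap _ _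
  · exact (isSeparableMap_krausMap _ _).add (isSeparableMap_krausMap _ _)
  · exact (isSeparableMap_krausMap _ _).add (isSeparableMap_krausMap _ _)

/-! ### The closures of LOCC and of finite-round LOCC -/

section Bipartite

variable {a b : Type} [Fintype a] [Fintype b]

theorem IsCoarseGraining.refl {n Θ : Type} (J : Family n Θ) : IsCoarseGraining J J := by
  refine ⟨id, fun k ρ => ?_⟩
  have : Unique {j : Θ // id j = k} := ⟨⟨⟨k, rfl⟩⟩, fun x => Subtype.ext x.2⟩
  convert hasSum_unique (fun j : {j : Θ // id j = k} => J j ρ)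
  exact (this.default.2).symm

theorem oneWayLocal_id : OneWayLocal (fun _ : Unit => (LinearMap.id : SuperOp (a × b))) :=
  Or.inl ⟨isInstrument_of_fintype (fun _ => isCP_id) (fun _ => by simp),
    fun _ => ⟨LinearMap.id, LinearMap.id, isCP_id, isTCP_id, rfl⟩⟩

theorem IsCoarseGraining.linkedTo {Θ Θ' : Type} {J : Family (a × b) Θ} {J' : Family (a × b) Θ'}
    (h : IsCoarseGraining J J') : LinkedTo J' J := by
  obtain ⟨g, hg⟩ := h
  refine ⟨fun _ => Unit, fun _ _ => LinearMap.id, fun _ => oneWayLocal_id, fun p => g p.1,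
    fun k ρ => ?_⟩
  let e : {p : (Σ _ : Θ, Unit) // g p.1 = k} ≃ {j // g j = k} :=
    { toFun := fun p => ⟨p.1.1, p.2⟩
      invFun := fun j => ⟨⟨j.1, ()⟩, j.2⟩
      left_inv := fun _ => rfl
      right_inv := fun _ => rfl }
  exact e.hasSum_iff.2 (hg k ρ)

theorem isInstrument_of_mem_LOCCFin {Θ : Type} {J : Family (a × b) Θ} (h : J ∈ LOCCFin a b Θ) :
    IsInstrument J := by
  obtain ⟨r, hr, h⟩ := h
  match r, h with
  | 1, h =>
    obtain ⟨_, _, -, -, hJ⟩ := h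
    exact hJ
  | r + 2, h =>
    obtain ⟨_, _, -, -, hJ⟩ := h
    exact hJ

theorem LinkedTo.mem_LOCCFin {Θ Θ' : Type} {J : Family (a × b) Θ} {J' : Family (a × b) Θ'}
    (h : LinkedTo J' J) (hJ : J ∈ LOCCFin a b Θ) (hJ' : IsInstrument J') :
    J' ∈ LOCCFin a b Θ' := by
  obtain ⟨r, hr, hJ⟩ := hJ
  obtain ⟨r, rfl⟩ := Nat.exists_eq_add_of_le' hr
  exact ⟨r + 2, by omega, Θ, J, hJ, h, hJ'⟩

variable [DecidableEq a] [DecidableEq b]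

theorem LOCCFin_subset_LOCCInst {Θ : Type} [Fintype Θ] : LOCCFin a b Θ ⊆ LOCCInst a b Θ := by
  intro J hJ
  have hI := isInstrument_of_mem_LOCCFin hJ
  exact ⟨hI, fun _ => Θ, fun _ => J, fun _ => hJ, fun _ => (IsCoarseGraining.refl J).linkedTo,
    fun _ => J, fun _ => ⟨hI, IsCoarseGraining.refl J⟩, convergesTo_iff.2 tendsto_const_nhds⟩

theorem LOCCInst_subset_instClosure {Θ : Type} : LOCCInst a b Θ ⊆ instClosure (LOCCFin a b Θ) := by
  rintro J ⟨hI, I, s, hs, -, s', hs', h⟩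
  exact ⟨hI, s', fun ν => (hs' ν).2.linkedTo.mem_LOCCFin (hs ν) (hs' ν).1, h⟩

theorem instClosure_LOCCInst {Θ : Type} [Fintype Θ] :
    instClosure (LOCCInst a b Θ) = instClosure (LOCCFin a b Θ) := by
  ext J
  rw [mem_instClosure_iff, mem_instClosure_iff]
  refine and_congr_right fun _ => ⟨fun h => ?_, fun h => ?_⟩
  · refine closure_minimal ?_ isClosed_closure h
    rintro _ ⟨J', hJ', rfl⟩
    exact (mem_instClosure_iff.1 (LOCCInst_subset_instClosure hJ')).2
  · exact closure_mono (Set.image_mono LOCCFin_subset_LOCCInst) h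

end Bipartite

/-! ### A protocol that approximates the target instrument -/

theorem hasSum_subtype_of_fintype {X E : Type} [Fintype X] [AddCommMonoid E] [TopologicalSpace E]
    (p : X → Prop) [DecidablePred p] (F : X → E) :
    HasSum (fun x : {x // p x} => F x) (∑ x, if p x then F x else 0) := by
  rw [← Finset.sum_filter, Finset.sum_subtype (p := p) _ (by simp) F]
  exact hasSum_fintype _

/-- Conditioned on the outcome `0`, a one-way local measurement with two outcomes is performed.
The first outcome is kept as `0` and the second is counted as `t`. -/
theorem mem_LOCCFin_of_step {J J' : Family (Fin 2 × Fin 2) (Fin 3)}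
    (hJ : J ∈ LOCCFin (Fin 2) (Fin 2) (Fin 3)) {F : Family (Fin 2 × Fin 2) (Fin 2)}
    (hF : OneWayLocal F) {t : Fin 3} (ht : t ≠ 0) (h0 : J' 0 = F 0 ∘ₗ J 0)
    (h1 : J' t = J t + F 1 ∘ₗ J 0) (h2 : ∀ j, j ≠ 0 → j ≠ t → J' j = J j)
    (hcp : ∀ j, IsCP (J' j)) : J' ∈ LOCCFin (Fin 2) (Fin 2) (Fin 3) := by
  have hid : OneWayLocal
      (![LinearMap.id, 0] : Family (Fin 2 × Fin 2) (Fin 2)) := by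
    refine Or.inl ⟨isInstrument_of_fintype (fun j => ?_) (fun ρ => ?_), fun j => ?_⟩
    · fin_cases j
      · exact isCP_id
      · exact isCP_zero
    · simp
    · fin_cases j
      · exact ⟨LinearMap.id, LinearMap.id, isCP_id, isTCP_id, rfl⟩
      · exact ⟨0, LinearMap.id, isCP_zero, isTCP_id, rfl⟩
  have hlink : LinkedTo J' J := by
    refine ⟨fun _ => Fin 2, fun j => if j = 0 then F else ![LinearMap.id, 0],
      fun j => ?_, fun p => if p.1 = 0 ∧ p.2 = 1 then t else p.1, fun k ρ => ?_⟩
    · dsimp only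
      split_ifs
      · exact hF
      · exact hid
    · have e : J' k ρ = ∑ p : (Σ _ : Fin 3, Fin 2),
          if (if p.1 = 0 ∧ p.2 = 1 then t else p.1) = k
            then (if p.1 = 0 then F else ![LinearMap.id, 0]) p.2 (J p.1 ρ) else 0 := by
        rw [Fintype.sum_sigma, Fin.sum_univ_three]
        simp only [Fin.sum_univ_two]
        by_cases hk0 : k = 0
        · subst hk0
          simp [ht, h0]
        · by_cases hkt : k = t
          · subst hkt
            rw [h1]
            fin_cases k
            · exact absurd rfl hk0
            · simpa using add_comm _ _
            · simp [add_comm]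
          · rw [h2 k hk0 hkt]
            fin_cases k
            · exact absurd rfl hk0
            · simpa using fun h : t = 1 => absurd h.symm hkt
            · simpa using fun h : t = 2 => absurd h.symm hkt
      rw [e]
      exact hasSum_subtype_of_fintype _ _
  refine hlink.mem_LOCCFin hJ (isInstrument_of_fintype hcp fun ρ => ?_)
  have hFt := hF.elim (fun h => h.1) (fun h => h.1)
  have e1 := (hFt.hasSum_trace (J 0 ρ)).unique (hasSum_fintype _)
  have e2 := ((isInstrument_of_mem_LOCCFin hJ).hasSum_trace ρ).unique (hasSum_fintype _)
  rw [Fin.sum_univ_two] at e1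
  rw [e2, Fin.sum_univ_three, Fin.sum_univ_three, e1, h0]
  have hcases : t = 1 ∨ t = 2 := by
    fin_cases t
    · exact absurd rfl ht
    · exact Or.inl rfl
    · exact Or.inr rfl
  rcases hcases with rfl | rfl
  · rw [h1, h2 2 (by decide) (by decide)]
    simp only [LinearMap.add_apply, LinearMap.comp_apply, Matrix.trace_add]
    ring
  · rw [h1, h2 1 (by decide) (by decide)]
    simp only [LinearMap.add_apply, LinearMap.comp_apply, Matrix.trace_add]
    ring

theorem oneWayLocalA_of_effects {K : Fin 2 → Matrix (Fin 2) (Fin 2) ℂ}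
    (h : (K 0)ᴴ * K 0 + (K 1)ᴴ * K 1 = 1) :
    OneWayLocal fun i : Fin 2 => krausMap (K i ⊗ₖ (1 : Matrix (Fin 2) (Fin 2) ℂ)) := by
  refine Or.inl ⟨isInstrument_of_fintype (fun _ => isCP_krausMap _) (fun ρ => ?_), fun i => ?_⟩
  · rw [Fin.sum_univ_two]
    simp only [trace_krausMap, Matrix.conjTranspose_kronecker, ← Matrix.mul_kronecker_mul]
    rw [← Matrix.trace_add, ← Matrix.add_mul, ← Matrix.add_kronecker, h]
    simp
  · refine ⟨krausMap (K i), LinearMap.id, isCP_krausMap _, isTCP_id, ?_⟩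
    refine superOp_ext_kronecker fun A B => ?_
    rw [tensorMap_kronecker, krausMap_kronecker, krausMap_one, LinearMap.id_apply]

theorem oneWayLocalB_of_effects {K : Fin 2 → Matrix (Fin 2) (Fin 2) ℂ}
    (h : (K 0)ᴴ * K 0 + (K 1)ᴴ * K 1 = 1) :
    OneWayLocal fun i : Fin 2 => krausMap ((1 : Matrix (Fin 2) (Fin 2) ℂ) ⊗ₖ K i) := by
  refine Or.inr ⟨isInstrument_of_fintype (fun _ => isCP_krausMap _) (fun ρ => ?_), fun i => ?_⟩
  · rw [Fin.sum_univ_two]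
    simp only [trace_krausMap, Matrix.conjTranspose_kronecker, ← Matrix.mul_kronecker_mul]
    rw [← Matrix.trace_add, ← Matrix.add_mul, ← Matrix.kronecker_add, h]
    simp
  · refine ⟨LinearMap.id, krausMap (K i), isTCP_id, isCP_krausMap _, ?_⟩
    refine superOp_ext_kronecker fun A B => ?_
    rw [tensorMap_kronecker, krausMap_kronecker, krausMap_one, LinearMap.id_apply]

/-- The filter `diag(u, 1)`. -/
def damp (u : ℝ) : Matrix (Fin 2) (Fin 2) ℂ := !![(u : ℂ), 0; 0, 1]

theorem damp_mul_damp (u v : ℝ) : damp u * damp v = damp (u * v) := by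
  ext i j
  fin_cases i <;> fin_cases j <;> simp [damp, Matrix.mul_apply, Fin.sum_univ_two]

theorem damp_zero : damp 0 = P1 := by simp [damp, P1]

theorem damp_one : damp 1 = 1 := by
  ext i j
  fin_cases i <;> fin_cases j <;> simp [damp]

theorem P0_mul_damp (u : ℝ) : P0 * damp u = (u : ℂ) • P0 := by
  ext i j
  fin_cases i <;> fin_cases j <;> simp [damp, P0, Matrix.mul_apply, Fin.sum_univ_two]

theorem isCP_ofReal_smul_krausMap {n : Type} [Fintype n] [DecidableEq n] {c : ℝ} (hc : 0 ≤ c)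
    (M : Matrix n n ℂ) : IsCP ((c : ℂ) • krausMap M) := by
  intro k X hX
  have : tensorMap LinearMap.id ((c : ℂ) • krausMap M) X
      = (c : ℂ) • tensorMap LinearMap.id (krausMap M) X := rfl
  rw [this]
  exact (isCP_krausMap M k X hX).smul (by exact_mod_cast hc)

theorem krausMap_ofReal_smul {n : Type} [Fintype n] (c : ℝ) (M : Matrix n n ℂ) :
    krausMap ((c : ℂ) • M) = ((c ^ 2 : ℝ) : ℂ) • krausMap M := by
  refine LinearMap.ext fun ρ => ?_
  rw [LinearMap.smul_apply, krausMap_apply, krausMap_apply, Matrix.conjTranspose_smul,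
    Matrix.smul_mul, Matrix.smul_mul, Matrix.mul_smul, smul_smul, Complex.star_def,
    Complex.conj_ofReal, Complex.ofReal_pow, sq]

/-- The two Kraus operators of the measurement that takes `diag(v, 1)` to `diag(u, 1)`, or else
projects onto `|0⟩`. -/
def dampKraus (v u : ℝ) : Fin 2 → Matrix (Fin 2) (Fin 2) ℂ :=
  ![damp (u / v), ((√(1 - (u / v) ^ 2) : ℝ) : ℂ) • P0]

theorem dampKraus_effects {v u : ℝ} (hv : 0 < v) (hu : 0 ≤ u) (huv : u ≤ v) :
    (dampKraus v u 0)ᴴ * dampKraus v u 0 + (dampKraus v u 1)ᴴ * dampKraus v u 1 = 1 := by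
  have h1 : (u / v) ^ 2 ≤ 1 := pow_le_one₀ (by positivity) ((div_le_one hv).2 huv)
  have h2 : ((√(1 - (u / v) ^ 2) : ℝ) : ℂ) * ((√(1 - (u / v) ^ 2) : ℝ) : ℂ)
      = 1 - ((u / v : ℝ) : ℂ) * ((u / v : ℝ) : ℂ) := by
    rw [← Complex.ofReal_mul, Real.mul_self_sqrt (by linarith)]
    push_cast
    ring
  simp only [dampKraus, Matrix.cons_val_zero, Matrix.cons_val_one]
  generalize ((√(1 - (u / v) ^ 2) : ℝ)) = s at h2
  generalize u / v = r at h2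
  ext i j
  fin_cases i <;> fin_cases j <;>
    simp [damp, P0, Matrix.mul_apply, Fin.sum_univ_two, h2]

theorem dampKraus_zero_mul {v u : ℝ} (hv : 0 < v) : dampKraus v u 0 * damp v = damp u := by
  simp only [dampKraus, Matrix.cons_val_zero, damp_mul_damp, div_mul_cancel₀ _ hv.ne']

theorem dampKraus_one_mul (v u : ℝ) :
    dampKraus v u 1 * damp v = ((√(1 - (u / v) ^ 2) * v : ℝ) : ℂ) • P0 := by
  change (((√(1 - (u / v) ^ 2) : ℝ) : ℂ) • P0) * damp v = _
  rw [Matrix.smul_mul, P0_mul_damp, smul_smul, Complex.ofReal_mul]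

theorem dampKraus_weight {v u : ℝ} (hv : 0 < v) (hu : 0 ≤ u) (huv : u ≤ v) :
    (√(1 - (u / v) ^ 2) * v) ^ 2 = v ^ 2 - u ^ 2 := by
  have h1 : (u / v) ^ 2 ≤ 1 := pow_le_one₀ (by positivity) ((div_le_one hv).2 huv)
  rw [mul_pow, Real.sq_sqrt (by linarith)]
  field_simp

/-- The instrument obtained after `m` cycles of the protocol along a decreasing sequence `u`: in
the `i`-th cycle first Alice and then Bob filters from `diag(u i, 1)` to `diag(u (i + 1), 1)`. A
failed filter projects the acting party onto `|0⟩` and ends the protocol. -/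
def protocol (u : ℕ → ℝ) (m : ℕ) : Family (Fin 2 × Fin 2) (Fin 3) :=
  ![krausMap (damp (u m) ⊗ₖ damp (u m)),
    ∑ i ∈ Finset.range m,
      ((u i ^ 2 - u (i + 1) ^ 2 : ℝ) : ℂ) • krausMap (damp (u (i + 1)) ⊗ₖ P0),
    ∑ i ∈ Finset.range m, ((u i ^ 2 - u (i + 1) ^ 2 : ℝ) : ℂ) • krausMap (P0 ⊗ₖ damp (u i))]

theorem isCP_sum {n ι : Type} [Fintype n] {s : Finset ι} {Φ : ι → SuperOp n}
    (h : ∀ i ∈ s, IsCP (Φ i)) : IsCP (∑ i ∈ s, Φ i) := by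
  classical
  induction s using Finset.induction_on with
  | empty => exact isCP_zero
  | insert i s hi ih =>
    rw [Finset.sum_insert hi]
    exact (h i (Finset.mem_insert_self i s)).add
      (ih fun j hj => h j (Finset.mem_insert_of_mem hj))

theorem krausMap_comp {n : Type} [Fintype n] (M N : Matrix n n ℂ) :
    krausMap M ∘ₗ krausMap N = krausMap (M * N) :=
  LinearMap.ext fun ρ => (krausMap_mul M N ρ).symm

theorem protocol_mem_LOCCFin {u : ℕ → ℝ} (h0 : u 0 = 1) {m : ℕ} (hpos : ∀ i < m, 0 < u i)
    (hnn : 0 ≤ u m) (hanti : ∀ i < m, u (i + 1) ≤ u i) :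
    protocol u m ∈ LOCCFin (Fin 2) (Fin 2) (Fin 3) := by
  induction m with
  | zero =>
    have e : protocol u 0 = ![LinearMap.id, 0, 0] := by
      simp only [protocol, Finset.range_zero, Finset.sum_empty, h0, damp_one,
        Matrix.one_kronecker_one]
      congr 1
      exact LinearMap.ext krausMap_one
    rw [e]
    have hI : IsInstrument (![LinearMap.id, 0, 0] : Family (Fin 2 × Fin 2) (Fin 3)) := by
      refine isInstrument_of_fintype (fun j => ?_) (fun ρ => ?_)
      · fin_cases j
        · exact isCP_id
        · exact isCP_zero
        · exact isCP_zero
      · simp [Fin.sum_univ_three]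
    refine ⟨1, le_rfl, Fin 3, _, Or.inl ⟨hI, fun j => ?_⟩, IsCoarseGraining.refl _, hI⟩
    fin_cases j
    · exact ⟨LinearMap.id, LinearMap.id, isCP_id, isTCP_id, rfl⟩
    · exact ⟨0, LinearMap.id, isCP_zero, isTCP_id, rfl⟩
    · exact ⟨0, LinearMap.id, isCP_zero, isTCP_id, rfl⟩
  | succ m ih =>
    have hm := hpos m m.lt_succ_self
    have hle := hanti m m.lt_succ_self
    have hJ := ih (fun i hi => hpos i (hi.trans m.lt_succ_self)) hm.le
      (fun i hi => hanti i (hi.trans m.lt_succ_self))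
    have hc : ∀ i < m + 1, 0 ≤ u i ^ 2 - u (i + 1) ^ 2 := fun i hi => by
      have h1 : 0 ≤ u (i + 1) := by
        rcases Nat.lt_or_ge (i + 1) (m + 1) with h | h
        · exact (hpos _ h).le
        · obtain rfl : i = m := by omega
          exact hnn
      exact sub_nonneg.2 (pow_le_pow_left₀ h1 (hanti i hi) 2)
    have heff := dampKraus_effects hm hnn hle
    have hw := dampKraus_weight hm hnn hle
    have hcp1 : ∀ k ≤ m + 1, IsCP (∑ i ∈ Finset.range k,
        ((u i ^ 2 - u (i + 1) ^ 2 : ℝ) : ℂ) • krausMap (damp (u (i + 1)) ⊗ₖ P0)) :=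
      fun k hk => isCP_sum fun i hi =>
        isCP_ofReal_smul_krausMap (hc i ((Finset.mem_range.1 hi).trans_le hk)) _
    have hcp2 : IsCP (∑ i ∈ Finset.range (m + 1),
        ((u i ^ 2 - u (i + 1) ^ 2 : ℝ) : ℂ) • krausMap (P0 ⊗ₖ damp (u i))) :=
      isCP_sum fun i hi => isCP_ofReal_smul_krausMap (hc i (Finset.mem_range.1 hi)) _
    -- The instrument between Alice's and Bob's filter.
    have hhalf : ![krausMap (damp (u (m + 1)) ⊗ₖ damp (u m)), protocol u m 1,
        protocol u (m + 1) 2] ∈ LOCCFin (Fin 2) (Fin 2) (Fin 3) := by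
      refine mem_LOCCFin_of_step hJ (oneWayLocalA_of_effects heff) (t := 2) (by decide) ?_ ?_ ?_ ?_
      · change _ = _ ∘ₗ krausMap (damp (u m) ⊗ₖ damp (u m))
        rw [krausMap_comp, ← Matrix.mul_kronecker_mul, dampKraus_zero_mul hm, one_mul]
        rfl
      · change _ = _ + _ ∘ₗ krausMap (damp (u m) ⊗ₖ damp (u m))
        rw [krausMap_comp, ← Matrix.mul_kronecker_mul, dampKraus_one_mul, one_mul,
          Matrix.smul_kronecker, krausMap_ofReal_smul, hw]
        exact Finset.sum_range_succ _ _
      · intro j hj0 hj2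
        fin_cases j
        · exact absurd rfl hj0
        · rfl
        · exact absurd rfl hj2
      · intro j
        fin_cases j
        · exact isCP_krausMap _
        · exact hcp1 m m.le_succ
        · exact hcp2
    refine mem_LOCCFin_of_step hhalf (oneWayLocalB_of_effects heff) (t := 1) (by decide) ?_ ?_ ?_ ?_
    · change _ = _ ∘ₗ krausMap (damp (u (m + 1)) ⊗ₖ damp (u m))
      rw [krausMap_comp, ← Matrix.mul_kronecker_mul, dampKraus_zero_mul hm, one_mul]
      rfl
    · change _ = _ + _ ∘ₗ krausMap (damp (u (m + 1)) ⊗ₖ damp (u m))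
      rw [krausMap_comp, ← Matrix.mul_kronecker_mul, dampKraus_one_mul, one_mul,
        Matrix.kronecker_smul, krausMap_ofReal_smul, hw]
      exact Finset.sum_range_succ _ _
    · intro j hj0 hj1
      fin_cases j
      · exact absurd rfl hj0
      · exact absurd rfl hj1
      · rfl
    · intro j
      fin_cases j
      · exact isCP_krausMap _
      · exact hcp1 (m + 1) le_rfl
      · exact hcp2

/-! ### The limit of the protocol -/

/-- The grid `1, 1 - 1/N, 1 - 2/N, …` with `N = n + 1` steps down to `0`. -/
def grid (n i : ℕ) : ℝ := 1 - i * (1 / ((n : ℝ) + 1))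

theorem grid_zero (n : ℕ) : grid n 0 = 1 := by simp [grid]

theorem grid_last (n : ℕ) : grid n (n + 1) = 0 := by
  have : (n : ℝ) + 1 ≠ 0 := by positivity
  rw [grid, Nat.cast_add, Nat.cast_one, mul_one_div_cancel this, sub_self]

theorem grid_succ (n i : ℕ) : grid n (i + 1) = grid n i - 1 / ((n : ℝ) + 1) := by
  rw [grid, grid]
  push_cast
  ring

theorem grid_pos {n i : ℕ} (h : i < n + 1) : 0 < grid n i := by
  have h1 : (i : ℝ) < (n : ℝ) + 1 := by exact_mod_cast h
  rw [grid, sub_pos, mul_one_div, div_lt_one (by positivity)]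
  exact h1

theorem tendsto_sum_of_telescoping {w : ℕ → ℕ → ℝ} {Q : ℝ → ℝ → ℝ} {c : ℝ}
    (hw : ∀ n i, w n i = Q (1 / ((n : ℝ) + 1)) (grid n i) - Q (1 / ((n : ℝ) + 1)) (grid n (i + 1)))
    (hc : Continuous fun h => Q h 1 - Q h 0) (h0 : Q 0 1 - Q 0 0 = c) :
    Tendsto (fun n => ∑ i ∈ Finset.range (n + 1), w n i) atTop (𝓝 c) := by
  have e : ∀ n, ∑ i ∈ Finset.range (n + 1), w n i
      = Q (1 / ((n : ℝ) + 1)) 1 - Q (1 / ((n : ℝ) + 1)) 0 := fun n => by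
    simp only [hw]
    rw [Finset.sum_range_sub', grid_zero, grid_last]
  simp only [e]
  rw [← h0]
  exact (hc.tendsto 0).comp tendsto_one_div_add_atTop_nhds_zero_nat

/-- `∑ (u_i² - u_{i+1}²) u_i → ∫ √t dt` over `[0, 1]`; each summand is a difference of values of a
cubic polynomial in `u`. -/
theorem tendsto_sum_grid_left : Tendsto (fun n => ∑ i ∈ Finset.range (n + 1),
    (grid n i ^ 2 - grid n (i + 1) ^ 2) * grid n i) atTop (𝓝 (2 / 3)) := by
  refine tendsto_sum_of_telescoping
    (Q := fun h u => 2 / 3 * u ^ 3 + h / 2 * u ^ 2 - h ^ 2 / 6 * u) (fun n i => ?_)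
    (by fun_prop) (by norm_num)
  rw [grid_succ]
  ring

theorem tendsto_sum_grid_right : Tendsto (fun n => ∑ i ∈ Finset.range (n + 1),
    (grid n i ^ 2 - grid n (i + 1) ^ 2) * grid n (i + 1)) atTop (𝓝 (2 / 3)) := by
  refine tendsto_sum_of_telescoping
    (Q := fun h u => 2 / 3 * u ^ 3 - h / 2 * u ^ 2 - h ^ 2 / 6 * u) (fun n i => ?_)
    (by fun_prop) (by norm_num)
  rw [grid_succ]
  ring

theorem tendsto_sum_grid_left_sq : Tendsto (fun n => ∑ i ∈ Finset.range (n + 1),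
    (grid n i ^ 2 - grid n (i + 1) ^ 2) * grid n i ^ 2) atTop (𝓝 (1 / 2)) := by
  refine tendsto_sum_of_telescoping
    (Q := fun h u => u ^ 4 / 2 + 2 / 3 * h * u ^ 3 - h ^ 3 / 6 * u) (fun n i => ?_)
    (by fun_prop) (by norm_num)
  rw [grid_succ]
  ring

theorem tendsto_sum_grid_right_sq : Tendsto (fun n => ∑ i ∈ Finset.range (n + 1),
    (grid n i ^ 2 - grid n (i + 1) ^ 2) * grid n (i + 1) ^ 2) atTop (𝓝 (1 / 2)) := by
  refine tendsto_sum_of_telescoping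
    (Q := fun h u => u ^ 4 / 2 - 2 / 3 * h * u ^ 3 + h ^ 3 / 6 * u) (fun n i => ?_)
    (by fun_prop) (by norm_num)
  rw [grid_succ]
  ring

theorem tendsto_sum_grid_one : Tendsto (fun n => ∑ i ∈ Finset.range (n + 1),
    (grid n i ^ 2 - grid n (i + 1) ^ 2)) atTop (𝓝 1) :=
  tendsto_sum_of_telescoping (Q := fun _ u => u ^ 2) (fun _ _ => rfl) (by fun_prop) (by norm_num)

/-- The entries of `T1` and `T2` combine to the multiplier `(1/2, 2/3; 2/3, 1)`, the integral
of `(t, √t; √t, 1)` over `[0, 1]`. -/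
theorem tendsto_sum_damp {v : ℕ → ℕ → ℝ}
    (h1 : Tendsto (fun n => ∑ i ∈ Finset.range (n + 1),
      (grid n i ^ 2 - grid n (i + 1) ^ 2) * v n i) atTop (𝓝 (2 / 3)))
    (h2 : Tendsto (fun n => ∑ i ∈ Finset.range (n + 1),
      (grid n i ^ 2 - grid n (i + 1) ^ 2) * v n i ^ 2) atTop (𝓝 (1 / 2))) (p q k l : Fin 2) :
    Tendsto (fun n => ∑ i ∈ Finset.range (n + 1), ((grid n i ^ 2 - grid n (i + 1) ^ 2 : ℝ) : ℂ)
      * (damp (v n i) p k * star (damp (v n i) q l))) atTop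
      (𝓝 (T1 p k * star (T1 q l) + T2 p k * star (T2 q l))) := by
  have e3 := one_div_sqrt_three_mul_self
  have e6 := one_div_sqrt_six_mul_self
  have e6' := one_div_sqrt_six_mul_sqrt
  have e23 : √(2 / 3 : ℝ) * √(2 / 3) = 2 / 3 := Real.mul_self_sqrt (by norm_num)
  have hT : ∀ x y : ℝ, ∀ p k, !![(x : ℂ), 0; 0, (y : ℂ)] p k
      = ((!![x, 0; 0, y] p k : ℝ) : ℂ) := by
    intro x y p k
    fin_cases p <;> fin_cases k <;> simp
  have hD : ∀ x : ℝ, ∀ p k, damp x p k = ((!![x, 0; 0, 1] p k : ℝ) : ℂ) := by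
    intro x p k
    fin_cases p <;> fin_cases k <;> simp [damp]
  have hreal : Tendsto (fun n => ∑ i ∈ Finset.range (n + 1), (grid n i ^ 2 - grid n (i + 1) ^ 2)
      * (!![v n i, 0; 0, 1] p k * !![v n i, 0; 0, 1] q l)) atTop
      (𝓝 (!![1 / √3, 0; 0, 1 / √3] p k * !![1 / √3, 0; 0, 1 / √3] q l
        + !![1 / √6, 0; 0, √(2 / 3)] p k * !![1 / √6, 0; 0, √(2 / 3)] q l)) := by
    have z : Tendsto (fun n : ℕ => ∑ i ∈ Finset.range (n + 1),
        (grid n i ^ 2 - grid n (i + 1) ^ 2) * 0) atTop (𝓝 0) := by simp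
    by_cases hpk : p = k
    · by_cases hql : q = l
      · subst hpk hql
        fin_cases p <;> fin_cases q
        · convert h2 using 4
          · simp [sq]
          · exact (congrArg₂ (· + ·) e3 e6).trans (by norm_num)
        · convert h1 using 4
          · simp
          · exact (congrArg₂ (· + ·) e3 e6').trans (by norm_num)
        · convert h1 using 4
          · simp
          · exact (congrArg₂ (· + ·) e3 ((mul_comm _ _).trans e6')).trans (by norm_num)
        · convert tendsto_sum_grid_one using 4
          · simp
          · exact (congrArg₂ (· + ·) e3 e23).trans (by norm_num)
      · convert z using 4
        · fin_cases q <;> fin_cases l <;> first | exact absurd rfl hql | simp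
        · fin_cases q <;> fin_cases l <;> first | exact absurd rfl hql | simp
    · convert z using 4
      · fin_cases p <;> fin_cases k <;> first | exact absurd rfl hpk | simp
      · fin_cases p <;> fin_cases k <;> first | exact absurd rfl hpk | simp
  have hcomplex := (Complex.continuous_ofReal.tendsto _).comp hreal
  simp only [T1, T2, hT, hD, Complex.star_def, Complex.conj_ofReal]
  convert hcomplex using 2
  · simp
  · simp

theorem sum_smul_krausMap_single_apply (m : ℕ) (c : ℕ → ℂ) (M N : ℕ → Matrix (Fin 2) (Fin 2) ℂ)
    (k l p q : Fin 2 × Fin 2) :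
    (∑ i ∈ Finset.range m, c i • krausMap (M i ⊗ₖ N i)) (Matrix.single k l 1) p q
      = ∑ i ∈ Finset.range m, c i * ((M i p.1 k.1 * star (M i q.1 l.1))
        * (N i p.2 k.2 * star (N i q.2 l.2))) := by
  rw [LinearMap.sum_apply, Matrix.sum_apply]
  refine Finset.sum_congr rfl fun i _ => ?_
  rw [LinearMap.smul_apply, Matrix.smul_apply, krausMap_single_apply,
    Matrix.kroneckerMap_apply, Matrix.kroneckerMap_apply, star_mul', smul_eq_mul]
  ring

theorem protocol_one_apply (u : ℕ → ℝ) (m : ℕ) (k l p q : Fin 2 × Fin 2) :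
    protocol u m 1 (Matrix.single k l 1) p q
      = (∑ i ∈ Finset.range m, ((u i ^ 2 - u (i + 1) ^ 2 : ℝ) : ℂ)
        * (damp (u (i + 1)) p.1 k.1 * star (damp (u (i + 1)) q.1 l.1)))
          * (P0 p.2 k.2 * star (P0 q.2 l.2)) := by
  refine (sum_smul_krausMap_single_apply m _ (fun i => damp (u (i + 1))) (fun _ => P0)
    k l p q).trans ?_
  simp only [Finset.sum_mul, mul_assoc]

theorem protocol_two_apply (u : ℕ → ℝ) (m : ℕ) (k l p q : Fin 2 × Fin 2) :
    protocol u m 2 (Matrix.single k l 1) p q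
      = (∑ i ∈ Finset.range m, ((u i ^ 2 - u (i + 1) ^ 2 : ℝ) : ℂ)
        * (damp (u i) p.2 k.2 * star (damp (u i) q.2 l.2)))
          * (P0 p.1 k.1 * star (P0 q.1 l.1)) := by
  refine (sum_smul_krausMap_single_apply m _ (fun _ => P0) (fun i => damp (u i))
    k l p q).trans ?_
  rw [Finset.sum_mul]
  exact Finset.sum_congr rfl fun i _ => by ring

theorem convergesTo_protocol :
    ConvergesTo (fun n => protocol (grid n) (n + 1)) targetInstrument := by
  refine convergesTo_of_tendsto_apply fun j k l p q => ?_
  have hA := tendsto_sum_damp tendsto_sum_grid_right tendsto_sum_grid_right_sq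
  have hB := tendsto_sum_damp tendsto_sum_grid_left tendsto_sum_grid_left_sq
  fin_cases j
  · have e : ∀ n, protocol (grid n) (n + 1) 0 = E00 := fun n => by
      change krausMap (damp (grid n (n + 1)) ⊗ₖ damp (grid n (n + 1))) = E00
      rw [grid_last, damp_zero, E00]
    refine tendsto_const_nhds.congr fun n => ?_
    exact (congrArg (fun Φ : SuperOp (Fin 2 × Fin 2) => Φ (Matrix.single k l 1) p q) (e n)).symm
  · have h := (hA p.1 q.1 k.1 l.1).mul_const (P0 p.2 k.2 * star (P0 q.2 l.2))
    convert h using 2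
    · exact protocol_one_apply _ _ _ _ _ _
    · change (krausMap (T1 ⊗ₖ P0) (Matrix.single k l 1) p q
        + krausMap (T2 ⊗ₖ P0) (Matrix.single k l 1) p q) = _
      rw [krausMap_single_apply, krausMap_single_apply]
      simp only [Matrix.kroneckerMap_apply, star_mul']
      ring
  · have h := (hB p.2 q.2 k.2 l.2).mul_const (P0 p.1 k.1 * star (P0 q.1 l.1))
    convert h using 2
    · exact protocol_two_apply _ _ _ _ _ _
    · change (krausMap (P0 ⊗ₖ T1) (Matrix.single k l 1) p q
        + krausMap (P0 ⊗ₖ T2) (Matrix.single k l 1) p q) = _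
      rw [krausMap_single_apply, krausMap_single_apply]
      simp only [Matrix.kroneckerMap_apply, star_mul']
      ring

theorem targetInstrument_mem_instClosure :
    targetInstrument ∈ instClosure (LOCCFin (Fin 2) (Fin 2) (Fin 3)) :=
  ⟨isInstrument_targetInstrument, _, fun n =>
    protocol_mem_LOCCFin (grid_zero n) (fun _ hi => grid_pos hi) (grid_last n).ge
      (fun i _ => by
        have : 0 < 1 / ((n : ℝ) + 1) := by positivity
        rw [grid_succ]
        linarith), convergesTo_protocol⟩

end

end LOCC

theorem mainTheorem1 :
    LOCC.IsInstrument LOCC.targetInstrument ∧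
    LOCC.targetInstrument ∈ LOCC.SEP (Fin 2) (Fin 2) (Fin 3) ∧
    LOCC.targetInstrument ∈ LOCC.instClosure (LOCC.LOCCInst (Fin 2) (Fin 2) (Fin 3)) ∧
    LOCC.targetInstrument ∈ LOCC.instClosure (LOCC.LOCCFin (Fin 2) (Fin 2) (Fin 3)) ∧
    LOCC.instClosure (LOCC.LOCCInst (Fin 2) (Fin 2) (Fin 3)) =
      LOCC.instClosure (LOCC.LOCCFin (Fin 2) (Fin 2) (Fin 3)) ∧
    LOCC.targetInstrument ∉ LOCC.LOCCInst (Fin 2) (Fin 2) (Fin 3) ∧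
    LOCC.instClosure (LOCC.LOCCInst (Fin 2) (Fin 2) (Fin 3)) ≠
      LOCC.LOCCInst (Fin 2) (Fin 2) (Fin 3) := by
  have hcl : LOCC.targetInstrument ∈ LOCC.instClosure (LOCC.LOCCInst (Fin 2) (Fin 2) (Fin 3)) := by
    rw [LOCC.instClosure_LOCCInst]
    exact LOCC.targetInstrument_mem_instClosure
  exact ⟨LOCC.isInstrument_targetInstrument, LOCC.targetInstrument_mem_SEP, hcl,
    LOCC.targetInstrument_mem_instClosure, LOCC.instClosure_LOCCInst,
    LOCC.targetInstrument_notMem_LOCCInst,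
    fun h => LOCC.targetInstrument_notMem_LOCCInst (h ▸ hcl)⟩
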